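/- Let $\mathcal{D}\subset\mathbb{R}^{n}$ be open, let $P$ be a $p\times m$ matrix of real rational functions of $s$, and for each $\mu\in\mathcal{D}$ let $K(\mu)$ be an $m\times p$ matrix of real rational functions of $s$ (neither $P$ nor $K(\mu)$ is assumed proper). For each $\mu\in\mathcal{D}$ let the feedback loop $$y_1=u_1+P\,y_2,\qquad y_2=u_2+K(\mu)\,y_1$$ be uniquely solvable, and let $G(\mu):(u_1,u_2)\mapsto(y_1,y_2)$ be its $(p+m)\times(p+m)$ transfer matrix. Assume that (i) the McMillan degree of $K(\mu)$, i.e. its number of poles in $\mathbb{C}\cup\{\infty\}$ counted with multiplicity (the degree of the least common denominator of all minors, plus the largest order of a pole at $\infty$ of a minor), is the same for all $\mu\in\mathcal{D}$; (ii) each entry of $K(\mu)$ is, for all $\mu\in\mathcal{D}$, a quotient of two polynomials in $s$ of bounded degree, with non-zero denominator, whose coefficients are continuous functions of $\mu$ on $\mathcal{D}$; (iii) $G(\mu)$ is strictly proper for all $\mu\in\mathcal{D}$. Let $c(\mu)=\tfrac12\|G(\mu)\|_{\mathcal{H}_2}^2\in[0,\infty]$, where $$\|G\|_{\mathcal{H}_2}^2=\frac1{2\pi}\int_{-\infty}^{\infty}\operatorname{tr}\bigl(G(i\omega)\,G(-i\omega)^{\mathsf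 T}\bigr)\,d\omega$$ if all poles of $G$ have negative real part, and $\|G\|_{\mathcal{H}_2}^2=\infty$ otherwise. Then $c:\mathcal{D}\to[0,\infty]$ is continuous. -/

import Mathlib

open Polynomial MeasureTheory
open scoped ENNReal

noncomputable section

namespace HTwoCost

/-- A real-rational transfer matrix: entries in the field `ℝ(s)`, not assumed proper. -/
abbrev TransferMatrix (ι κ : Type) : Type := Matrix ι κ (RatFunc ℝ)

/-- Strict properness: in every entry the numerator has smaller degree than the denominator
(the zero polynomial has degree `⊥`). -/
def IsStrictlyProper {ι κ : Type} (A : TransferMatrix ι κ) : Prop :=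
  ∀ i j, (A i j).num.degree < (A i j).denom.degree

/-- Asymptotic stability: every (complex) pole of every entry has negative real part.
`RatFunc.num` and `RatFunc.denom` are coprime, so the poles are the roots of `denom`. -/
def IsStable {ι κ : Type} (A : TransferMatrix ι κ) : Prop :=
  ∀ i j, ∀ z : ℂ, aeval z (A i j).denom = 0 → z.re < 0

/-- The value `A(z)` of a transfer matrix at a complex point `z`. -/
def evalAt {ι κ : Type} (A : TransferMatrix ι κ) (z : ℂ) : Matrix ι κ ℂ :=
  A.map (RatFunc.eval (algebraMap ℝ ℂ) z)

/-- The integrand `tr (A(iω) B(-iω)ᵀ)` of the `H₂` inner product. -/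
def h2Integrand {ι κ : Type} [Fintype ι] [Fintype κ] (A B : TransferMatrix ι κ) (ω : ℝ) : ℂ :=
  (evalAt A (Complex.I * ω) * (evalAt B (-(Complex.I * ω))).transpose).trace

/-- For `A = B` the integrand is the squared Frobenius norm of `A(iω)`; in particular it is real
and nonnegative. -/
theorem h2Integrand_self {ι κ : Type} [Fintype ι] [Fintype κ] (A : TransferMatrix ι κ) (ω : ℝ) :
    h2Integrand A A ω = ((∑ i, ∑ j, ‖evalAt A (Complex.I * ω) i j‖ ^ 2 : ℝ) : ℂ) := by
  have key : ∀ q : ℝ[X], eval₂ (algebraMap ℝ ℂ) (-(Complex.I * ω)) q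
      = starRingEnd ℂ (eval₂ (algebraMap ℝ ℂ) (Complex.I * ω) q) := by
    intro q
    rw [Polynomial.hom_eval₂]
    congr 1
    · ext x
      simp
    · simp
  simp only [h2Integrand, Matrix.trace, Matrix.diag, Matrix.mul_apply, Matrix.transpose_apply]
  push_cast
  refine Finset.sum_congr rfl fun i _ => Finset.sum_congr rfl fun j _ => ?_
  have : evalAt A (-(Complex.I * ω)) i j
      = starRingEnd ℂ (evalAt A (Complex.I * ω) i j) := by
    simp only [evalAt, Matrix.map_apply, RatFunc.eval, map_div₀, key]
  rw [this, Complex.mul_conj']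

open Classical in
/-- The squared `H₂` norm, as an extended nonnegative real number:
`(1 / 2π) ∫ tr (A(iω) A(-iω)ᵀ) dω` if `A` is asymptotically stable, and `∞` if it is not. -/
def h2NormSq {ι κ : Type} [Fintype ι] [Fintype κ] (A : TransferMatrix ι κ) : ℝ≥0∞ :=
  if IsStable A then
    ENNReal.ofReal (1 / (2 * Real.pi)) * ∫⁻ ω : ℝ, ENNReal.ofReal (h2Integrand A A ω).re
  else ∞

/-- `G : (u₁, u₂) ↦ (y₁, y₂)` is the transfer matrix of the feedback loop
`y₁ = u₁ + P y₂`, `y₂ = u₂ + K y₁`: for all inputs, the loop equations have exactly one solution,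
and `G` produces it. -/
def IsFeedbackInterconnection {p m : ℕ} (P : TransferMatrix (Fin p) (Fin m))
    (K : TransferMatrix (Fin m) (Fin p))
    (G : TransferMatrix (Fin p ⊕ Fin m) (Fin p ⊕ Fin m)) : Prop :=
  ∀ (u₁ y₁ : Fin p → RatFunc ℝ) (u₂ y₂ : Fin m → RatFunc ℝ),
    (y₁ = u₁ + P.mulVec y₂ ∧ y₂ = u₂ + K.mulVec y₁) ↔
      Sum.elim y₁ y₂ = G.mulVec (Sum.elim u₁ u₂)

/-- Labels of the minors (of all orders, including the empty minor `1`) of an `m × p` matrix: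
lists of `k` rows and of `k` columns, `k ≤ m`. Lists with repetitions or in another order only add
zero minors and sign changes. -/
abbrev MinorIndex (m p : ℕ) : Type :=
  (k : Fin (m + 1)) × (Fin k → Fin m) × (Fin k → Fin p)

/-- The minor of `A` with the given rows and columns. -/
def minor {m p : ℕ} (A : TransferMatrix (Fin m) (Fin p)) (x : MinorIndex m p) : RatFunc ℝ :=
  (A.submatrix x.2.1 x.2.2).det

/-- The McMillan degree: the number of poles in `ℂ ∪ {∞}` with multiplicity. The finite poles are
the roots of the pole polynomial, the least common denominator of all minors; the multiplicity of
the pole at infinity is the largest order of a pole at infinity of a minor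
(`RatFunc.intDegree` is degree of numerator minus degree of denominator). -/
def mcMillanDegree {m p : ℕ} (A : TransferMatrix (Fin m) (Fin p)) : ℕ :=
  ((Finset.univ : Finset (MinorIndex m p)).lcm fun x => (minor A x).denom).natDegree
    + (Finset.univ : Finset (MinorIndex m p)).sup fun x => (minor A x).intDegree.toNat

/-- On `D`, every entry of `K(μ)` is a quotient `num(μ) / den(μ)` of real polynomials in `s` of
bounded degree with coefficients depending continuously on `μ`, where `den(μ) ≠ 0`. The quotient
need not be in lowest terms and leading coefficients may vanish. -/
def HasContinuousCoefficients {E : Type} [TopologicalSpace E] {m p : ℕ}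
    (K : E → TransferMatrix (Fin m) (Fin p)) (D : Set E) : Prop :=
  ∀ i j, ∃ (N : ℕ) (num den : E → ℝ[X]),
    (∀ k, ContinuousOn (fun μ => (num μ).coeff k) D) ∧
    (∀ k, ContinuousOn (fun μ => (den μ).coeff k) D) ∧
    ∀ μ ∈ D, (num μ).natDegree ≤ N ∧ (den μ).natDegree ≤ N ∧ den μ ≠ 0 ∧
      K μ i j = algebraMap ℝ[X] (RatFunc ℝ) (num μ) / algebraMap ℝ[X] (RatFunc ℝ) (den μ)

end HTwoCost

end

namespace HTwoCost

/-! The difficulty is that lowest-terms data of `K μ` may jump when factors cancel; constancy of the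
McMillan degree rules this out. The graph of `K` is the kernel of `[-K, 1]`, and its Plücker
coordinates, the maximal minors of that matrix, are up to sign the minors of `K`. Scaled to
polynomials without common factor, their largest degree is the McMillan degree
(`exists_isPrimitiveRep_graphMinor`). Take such representatives on the unit sphere of coefficients.
By compactness a subsequence converges to a nonzero vector of degree at most `d` proportional to the
coordinates of the limit point. Since that point also has degree `d`, there is no room for a common
factor, and the limit is again primitive (`IsPrimitiveRep.of_coeffTendsto`).

By Cauchy–Binet, a polynomial multiple `q` of `det (1 - K P)` is a bilinear pairing of the
representatives of `K` and `P`, so its coefficients converge as well. Properness of the loop forces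
`q` to have the full degree `d + δ`, and every root of `q` is a pole of `G` (`isFractionRep_loop`).
Hence `G = n / q` with convergent coefficients and constant degree of `q`.

The analytic half is `tendsto_h2NormSq`. If the limit is stable, dominated convergence applies. If
`q` has a root in the open right half-plane, nearby loops are unstable too. If it has one on the
imaginary axis, the limiting integral diverges, and Fatou's lemma drives the nearby costs to
infinity. -/

/-! ### Determinant identities: Cauchy–Binet and a rank-one update. -/

open Matrix Equiv in
theorem det_mul_eq_sum_det_submatrix {R κ : Type*} [CommRing R] [Fintype κ] {m : ℕ}
    (A : Matrix (Fin m) κ R) (B : Matrix κ (Fin m) R) :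
    (A * B).det = ∑ f : Fin m → κ, (A.submatrix id f).det * ∏ i, B (f i) i := by
  simp only [det_apply', mul_apply, Finset.prod_univ_sum, Finset.mul_sum, Finset.sum_mul,
    Fintype.piFinset_univ]
  rw [Finset.sum_comm]
  refine Finset.sum_congr rfl fun f _ => Finset.sum_congr rfl fun σ _ => ?_
  simp [Finset.prod_mul_distrib, mul_assoc]

open Matrix Equiv in
/-- The Cauchy–Binet formula, as a sum over all (not only increasing) selections. -/
theorem factorial_mul_det_mul {R κ : Type*} [CommRing R] [Fintype κ] {m : ℕ}
    (A : Matrix (Fin m) κ R) (B : Matrix κ (Fin m) R) :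
    (m.factorial : R) * (A * B).det
      = ∑ f : Fin m → κ, (A.submatrix id f).det * (B.submatrix f id).det := by
  -- Reindexing the selections by `σ` does not change the sum. Adding over all `σ` assembles the
  -- second determinant and produces the factor `m!`.
  have key : ∀ σ : Perm (Fin m), (A * B).det
      = ∑ f : Fin m → κ, (A.submatrix id f).det * ((Perm.sign σ : ℤ) * ∏ i, B (f (σ i)) i) := by
    intro σ
    rw [det_mul_eq_sum_det_submatrix]
    refine Fintype.sum_equiv (Equiv.arrowCongr σ (Equiv.refl κ)) _ _ fun f => ?_
    have h1 : (A.submatrix id (Equiv.arrowCongr σ (Equiv.refl κ) f)).det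
        = (Perm.sign σ : ℤ) * (A.submatrix id f).det := by
      have := det_permute' σ⁻¹ (A.submatrix id f)
      rw [Perm.sign_inv] at this
      exact this
    rw [h1]
    have h2 : ((Perm.sign σ : ℤ) : R) * ((Perm.sign σ : ℤ) : R) = 1 := by
      rw [← Int.cast_mul, ← Units.val_mul, Int.units_mul_self]; simp
    simp only [arrowCongr_apply, Function.comp_apply, symm_apply_apply, refl_apply]
    linear_combination (-(A.submatrix id f).det * ∏ i, B (f i) i) * h2
  have hcard : (m.factorial : R) * (A * B).det = ∑ _σ : Perm (Fin m), (A * B).det := by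
    simp [Fintype.card_perm]
  rw [hcard, Finset.sum_congr rfl fun σ _ => key σ, Finset.sum_comm]
  refine Finset.sum_congr rfl fun f _ => ?_
  rw [← Finset.mul_sum, det_apply' (B.submatrix f id)]
  rfl

open Matrix in
/-- The rank-one update formula for `det (C (1 + E_{ij}) B)`. -/
theorem det_mul_one_add_single_mul {F κ : Type*} [Field F] [Fintype κ] [DecidableEq κ] {m : ℕ}
    (C : Matrix (Fin m) κ F) (B : Matrix κ (Fin m) F) (h : (C * B).det ≠ 0) (i j : κ) :
    (C * ((1 + Matrix.single i j 1 : Matrix κ κ F) * B)).det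
      = (C * B).det * (1 + (B * (C * B)⁻¹ * C) j i) := by
  have hu : IsUnit (C * B).det := isUnit_iff_ne_zero.2 h
  -- With `C * B` factored out, Sylvester's identity `det (1 + X Y) = det (1 + Y X)` leaves a
  -- rank-one perturbation of the identity.
  have e1 : C * ((1 + Matrix.single i j 1 : Matrix κ κ F) * B)
      = (C * B) * (1 + ((C * B)⁻¹ * C * (Matrix.single i j 1 : Matrix κ κ F)) * B) := by
    rw [Matrix.add_mul, Matrix.mul_add, Matrix.mul_add, Matrix.one_mul, Matrix.mul_one]
    congr 1
    simp only [← Matrix.mul_assoc]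
    rw [Matrix.mul_nonsing_inv _ hu, Matrix.one_mul]
  have e2 : B * ((C * B)⁻¹ * C * (Matrix.single i j 1 : Matrix κ κ F))
      = Matrix.replicateCol Unit (fun k => (B * (C * B)⁻¹ * C) k i)
        * Matrix.replicateRow Unit (Pi.single j 1 : κ → F) := by
    ext a b
    rw [← Matrix.mul_assoc, ← Matrix.mul_assoc]
    by_cases hb : b = j
    · subst hb
      simp [mul_apply (M := replicateCol Unit _)]
    · simp [mul_apply (M := replicateCol Unit _), hb]
  rw [e1, Matrix.det_mul, Matrix.det_one_add_mul_comm, e2,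
    Matrix.det_one_add_replicateCol_mul_replicateRow, single_dotProduct, one_mul]

/-! ### Plücker coordinates of the graph of `K` and minors of `K`. -/

/-- The matrix `[-K, 1]`, whose kernel is the graph of `K`. -/
def graphAnnihilator {F : Type*} [Field F] {m p : ℕ} (K : Matrix (Fin m) (Fin p) F) :
    Matrix (Fin m) (Fin p ⊕ Fin m) F :=
  Matrix.fromCols (-K) 1

/-- The matrix `[P; 1]`, whose range is the (transposed) graph of `P`. -/
def graphBasis {F : Type*} [Field F] {m p : ℕ} (P : Matrix (Fin p) (Fin m) F) :
    Matrix (Fin p ⊕ Fin m) (Fin m) F :=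
  Matrix.fromRows P 1

theorem graphAnnihilator_mul_graphBasis {F : Type*} [Field F] {m p : ℕ}
    (K : Matrix (Fin m) (Fin p) F) (P : Matrix (Fin p) (Fin m) F) :
    graphAnnihilator K * graphBasis P = 1 - K * P := by
  rw [graphAnnihilator, graphBasis, Matrix.fromCols_mul_fromRows]
  simp [sub_eq_add_neg, add_comm]

/-- The maximal minors of `[-K, 1]`. -/
def graphMinor {F : Type*} [Field F] {m p : ℕ} (K : Matrix (Fin m) (Fin p) F)
    (f : Fin m → Fin p ⊕ Fin m) : F :=
  ((graphAnnihilator K).submatrix id f).det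

-- Once the rows are permuted by `σ`, the columns taken from the identity block are standard basis
-- vectors in their own positions. The matrix is block triangular, and only a block of `-K`
-- contributes.
open Matrix in
theorem det_permuted_graphAnnihilator {F : Type*} [Field F] {m p k : ℕ}
    (K : Matrix (Fin m) (Fin p) F)
    (f : Fin m → Fin p ⊕ Fin m) (σ : Equiv.Perm (Fin m)) (s : Fin m → Prop)
    [DecidablePred s] (e : Fin k ≃ {j // s j}) (c : Fin k → Fin p)
    (hs : ∀ l, f (e l) = Sum.inl (c l)) (hns : ∀ j, ¬ s j → f j = Sum.inr (σ j)) :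
    ((graphAnnihilator K).submatrix σ f).det
      = (-1) ^ k * (K.submatrix (fun l => σ (e l)) c).det := by
  have hz : ∀ i j, ¬ s j → ((graphAnnihilator K).submatrix σ f) i j = (1 : Matrix _ _ F) i j := by
    intro i j hj
    simp [graphAnnihilator, hns j hj, Matrix.one_apply]
  rw [Matrix.twoBlockTriangular_det' _ s]
  · have h1 : Matrix.toSquareBlockProp ((graphAnnihilator K).submatrix σ f) (fun i => ¬ s i) = 1 := by
      ext i j
      simp only [Matrix.toSquareBlockProp, Matrix.toBlock_apply]
      rw [hz _ _ j.2]
      simp [Matrix.one_apply, Subtype.ext_iff]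
    rw [h1, Matrix.det_one, mul_one, ← Matrix.det_submatrix_equiv_self e]
    have h2 : (Matrix.toSquareBlockProp ((graphAnnihilator K).submatrix σ f) s).submatrix e e
        = -(K.submatrix (fun l => σ (e l)) c) := by
      ext i j
      simp [Matrix.toSquareBlockProp, Matrix.toBlock_apply, graphAnnihilator, hs]
    rw [h2, Matrix.det_neg, Fintype.card_fin]
  · intro i hi j hj
    rw [hz i j hj, Matrix.one_apply_ne]
    rintro rfl
    exact hj hi

theorem sign_mul_graphMinor {F : Type*} [Field F] {m p : ℕ}
    (K : Matrix (Fin m) (Fin p) F) (f : Fin m → Fin p ⊕ Fin m) (σ : Equiv.Perm (Fin m)) :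
    ((graphAnnihilator K).submatrix σ f).det = (Equiv.Perm.sign σ : ℤ) * graphMinor K f := by
  have := Matrix.det_permute σ ((graphAnnihilator K).submatrix id f)
  exact this

theorem sign_mul_sign {R : Type*} [CommRing R] {m : ℕ} (σ : Equiv.Perm (Fin m)) :
    ((Equiv.Perm.sign σ : ℤ) : R) * ((Equiv.Perm.sign σ : ℤ) : R) = 1 := by
  rw [← Int.cast_mul, ← Units.val_mul, Int.units_mul_self]; simp

theorem neg_one_pow_mul_self {R : Type*} [CommRing R] (k : ℕ) :
    ((-1 : R) ^ k) * (-1) ^ k = 1 := by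
  rw [← mul_pow]; simp

/-- The coefficient is a sign, or `0` when a column of the identity block is selected twice. The
rows of the minor are those not hit by the selected identity columns. -/
theorem exists_graphMinor_eq_minor {m p : ℕ} (K : TransferMatrix (Fin m) (Fin p))
    (f : Fin m → Fin p ⊕ Fin m) :
    ∃ (c : ℤ) (x : MinorIndex m p), graphMinor K f = c * minor K x := by
  by_cases hinj : ∀ i j r, f i = Sum.inr r → f j = Sum.inr r → i = j
  · let s : Fin m → Prop := fun j => (f j).isLeft = true
    have hns : ∀ j : {j // ¬ s j}, ∃ r, f j = Sum.inr r := by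
      rintro ⟨j, hj⟩
      rcases h : f j with a | b
      · exact absurd (by simp [s, h]) hj
      · exact ⟨b, rfl⟩
    choose g hg using hns
    have hgi : Function.Injective g := by
      intro i j hij
      exact Subtype.ext (hinj _ _ _ (hg i) (hij ▸ hg j))
    let e₀ : {j // ¬ s j} ≃ {x // x ∈ Set.range g} := Equiv.ofInjective g hgi
    classical
    -- The injection from identity-block positions to rows extends to a permutation of all rows, as
    -- required by `det_permuted_graphAnnihilator`.
    let σ := e₀.extendSubtype
    have hσ : ∀ j, ¬ s j → f j = Sum.inr (σ j) := by
      intro j hj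
      rw [hg ⟨j, hj⟩, e₀.extendSubtype_apply_of_mem j hj]
      rfl
    have hss : ∀ j : {j // s j}, ∃ c, f j = Sum.inl c := by
      rintro ⟨j, hj⟩
      exact Sum.isLeft_iff.1 hj
    choose c hc using hss
    have hk : Fintype.card {j // s j} < m + 1 :=
      Nat.lt_succ_of_le ((Fintype.card_subtype_le s).trans (by simp))
    let e : Fin (Fintype.card {j // s j}) ≃ {j // s j} := (Fintype.equivFin _).symm
    have h1 := det_permuted_graphAnnihilator K f σ s e (fun l => c (e l)) (fun l => hc _) hσ
    rw [sign_mul_graphMinor] at h1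
    refine ⟨(Equiv.Perm.sign σ : ℤ) * (-1) ^ (Fintype.card {j // s j}),
      ⟨⟨_, hk⟩, fun l => σ (e l), fun l => c (e l)⟩, ?_⟩
    have h2 := sign_mul_sign (R := RatFunc ℝ) σ
    have h3 : minor K ⟨⟨_, hk⟩, fun l => σ (e l), fun l => c (e l)⟩
      = (K.submatrix (fun l => σ (e l)) fun l => c (e l)).det := rfl
    rw [h3]
    push_cast
    linear_combination (Equiv.Perm.sign σ : ℤ) * h1 - graphMinor K f * h2
  · push Not at hinj
    obtain ⟨i, j, r, hi, hj, hij⟩ := hinj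
    refine ⟨0, ⟨0, Fin.elim0, Fin.elim0⟩, ?_⟩
    rw [graphMinor, Matrix.det_zero_of_column_eq hij]
    · simp
    · intro k
      simp [hi, hj]

/-- In the identity block, the columns indexed by the rows of the minor are replaced by the chosen
columns of `K`. With the previous lemma, each family consists of integer multiples of members of the
other, so common factors and maximal degrees agree. -/
theorem exists_minor_eq_graphMinor {m p : ℕ} (K : TransferMatrix (Fin m) (Fin p))
    (x : MinorIndex m p) :
    ∃ (c : ℤ) (f : Fin m → Fin p ⊕ Fin m), minor K x = c * graphMinor K f := by
  obtain ⟨k, r, c⟩ := x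
  by_cases hr : Function.Injective r
  · classical
    let e : Fin k ≃ {j // j ∈ Set.range r} := Equiv.ofInjective r hr
    let f : Fin m → Fin p ⊕ Fin m := fun j =>
      if h : j ∈ Set.range r then Sum.inl (c (e.symm ⟨j, h⟩)) else Sum.inr j
    have h1 := det_permuted_graphAnnihilator K f 1 (fun j => j ∈ Set.range r) e c
      (fun l => by simp [f, e]) (fun j hj => by simp only [f, dif_neg hj]; rfl)
    rw [sign_mul_graphMinor] at h1
    refine ⟨(-1) ^ (k : ℕ), f, ?_⟩
    have h3 : minor K ⟨k, r, c⟩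
      = (K.submatrix (fun l => (1 : Equiv.Perm (Fin m)) (e l)) c).det := rfl
    rw [h3]
    have h2 := neg_one_pow_mul_self (R := RatFunc ℝ) k
    simp only [Equiv.Perm.sign_one, Units.val_one, Int.cast_one, one_mul] at h1
    rw [h1]
    push_cast
    rw [← mul_assoc, h2, one_mul]
  · rw [Function.not_injective_iff] at hr
    obtain ⟨i, j, h, hij⟩ := hr
    refine ⟨0, Sum.inr, ?_⟩
    rw [minor, Matrix.det_zero_of_row_eq hij]
    · simp
    · ext l
      simp [h]

/-! ### Primitive polynomial representatives and the McMillan degree. -/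

/-- `v` is a polynomial representative without common factor of the point of projective space with
homogeneous coordinates `a`, and `d` is the largest degree of its entries. -/
structure IsPrimitiveRep {ι : Type*} (a : ι → RatFunc ℝ) (d : ℕ) (v : ι → ℝ[X]) : Prop where
  exists_scale : ∃ h : RatFunc ℝ, h ≠ 0 ∧ ∀ x, algebraMap ℝ[X] (RatFunc ℝ) (v x) = h * a x
  span_eq_top : Ideal.span (Set.range v) = ⊤
  natDegree_le : ∀ x, (v x).natDegree ≤ d
  exists_coeff_ne_zero : ∃ x, (v x).coeff d ≠ 0

/-- Multiplying by the least common denominator `χ` gives the representative. The coordinate equal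
to `1` becomes `χ` itself, so a common factor would divide `χ` and could be removed to give a
smaller common denominator. -/
theorem isPrimitiveRep_lcm_denom {ι : Type*} [Fintype ι] (a : ι → RatFunc ℝ) (x₀ : ι)
    (h₀ : a x₀ = 1) :
    ∃ v : ι → ℝ[X], IsPrimitiveRep a
      ((Finset.univ.lcm fun x => (a x).denom).natDegree
        + Finset.univ.sup fun x => (a x).intDegree.toNat) v := by
  set χ := Finset.univ.lcm fun x => (a x).denom with hχ
  set S := Finset.univ.sup fun x => (a x).intDegree.toNat with hS
  have hdvd : ∀ x, (a x).denom ∣ χ := fun x => Finset.dvd_lcm (Finset.mem_univ x)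
  have hχ0 : χ ≠ 0 := by
    rw [hχ, Ne, Finset.lcm_eq_zero_iff]
    rintro ⟨x, -, hx⟩
    exact RatFunc.denom_ne_zero _ hx
  have hinj := RatFunc.algebraMap_injective ℝ
  have hχ0' : algebraMap ℝ[X] (RatFunc ℝ) χ ≠ 0 := by
    simpa using (map_ne_zero_iff _ hinj).2 hχ0
  have hv : ∀ x, ∃ q : ℝ[X], algebraMap ℝ[X] (RatFunc ℝ) q = algebraMap _ _ χ * a x := by
    intro x
    obtain ⟨t, ht⟩ := hdvd x
    refine ⟨t * (a x).num, ?_⟩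
    have hd : algebraMap ℝ[X] (RatFunc ℝ) (a x).denom ≠ 0 :=
      (map_ne_zero_iff _ hinj).2 (RatFunc.denom_ne_zero _)
    have hn := RatFunc.num_div_denom (a x)
    rw [div_eq_iff hd] at hn
    rw [ht, map_mul, map_mul, hn]
    ring
  choose v hv using hv
  have hvx₀ : v x₀ = χ := hinj (by rw [hv, h₀, mul_one])
  have hdeg : ∀ x, a x ≠ 0 → v x ≠ 0 ∧ ((v x).natDegree : ℤ) = χ.natDegree + (a x).intDegree := by
    intro x hx
    have hne : algebraMap ℝ[X] (RatFunc ℝ) (v x) ≠ 0 := by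
      rw [hv]; exact mul_ne_zero hχ0' hx
    refine ⟨fun h => hne (by rw [h, map_zero]), ?_⟩
    rw [← RatFunc.intDegree_polynomial, hv, RatFunc.intDegree_mul hχ0' hx,
      RatFunc.intDegree_polynomial]
  refine ⟨v, ⟨_, hχ0', hv⟩, ?_, ?_, ?_⟩
  · obtain ⟨g, hg⟩ := IsPrincipalIdealRing.principal (Ideal.span (Set.range v))
    have hg' : Ideal.span (Set.range v) = Ideal.span {g} := hg
    have hgv : ∀ x, g ∣ v x := fun x => by
      rw [← Ideal.mem_span_singleton, ← hg']
      exact Ideal.subset_span ⟨x, rfl⟩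
    rw [hg', Ideal.span_singleton_eq_top]
    obtain ⟨t, ht⟩ := hvx₀ ▸ hgv x₀
    have hg0 : g ≠ 0 := by rintro rfl; exact hχ0 (by rw [ht, zero_mul])
    have ht0 : t ≠ 0 := by rintro rfl; exact hχ0 (by rw [ht, mul_zero])
    -- `t = χ / g` is still a common denominator, so minimality of `χ` makes the common divisor `g`
    -- a unit.
    have hχt : χ ∣ t := by
      refine Finset.lcm_dvd fun x _ => ?_
      rw [RatFunc.denom_dvd ht0]
      obtain ⟨w, hw⟩ := hgv x
      refine ⟨w, ?_⟩
      have h1 := hv x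
      rw [hw, ht, map_mul, map_mul] at h1
      have hg1 : algebraMap ℝ[X] (RatFunc ℝ) g ≠ 0 := (map_ne_zero_iff _ hinj).2 hg0
      have ht1 : algebraMap ℝ[X] (RatFunc ℝ) t ≠ 0 := (map_ne_zero_iff _ hinj).2 ht0
      rw [eq_div_iff ht1]
      apply mul_left_cancel₀ hg1
      rw [h1]; ring
    obtain ⟨u, hu⟩ := hχt
    have : t * 1 = t * (g * u) := by
      rw [mul_one]
      nth_rw 1 [hu]
      rw [ht]; ring
    exact IsUnit.of_mul_eq_one u (mul_left_cancel₀ ht0 this).symm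
  · intro x
    by_cases hx : a x = 0
    · have : v x = 0 := hinj (by rw [hv, hx]; simp)
      simp [this]
    · have h1 := (hdeg x hx).2
      have h2 : (a x).intDegree.toNat ≤ S :=
        Finset.le_sup (f := fun x => (a x).intDegree.toNat) (Finset.mem_univ x)
      omega
  · obtain ⟨x, -, hx⟩ := Finset.exists_mem_eq_sup Finset.univ ⟨x₀, Finset.mem_univ _⟩
      (fun x => (a x).intDegree.toNat)
    rw [← hS] at hx
    -- Because of `toNat`, a maximiser for `S = 0` may have negative degree at infinity or be zero;
    -- `x₀` is then the safe witness.
    by_cases hS0 : S = 0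
    · refine ⟨x₀, ?_⟩
      rw [hS0, add_zero, hvx₀]
      simpa using hχ0
    · have hax : a x ≠ 0 := by
        rintro h
        rw [h, RatFunc.intDegree_zero] at hx
        exact hS0 (by simpa using hx)
      refine ⟨x, ?_⟩
      obtain ⟨hvx, h1⟩ := hdeg x hax
      have : χ.natDegree + S = (v x).natDegree := by omega
      rw [this]
      simpa using hvx

theorem exists_isPrimitiveRep_graphMinor {m p : ℕ} (K : TransferMatrix (Fin m) (Fin p)) :
    ∃ v, IsPrimitiveRep (graphMinor K) (mcMillanDegree K) v := by
  obtain ⟨u, ⟨h, h0, hu⟩, hspan, hdeg, ⟨y, hy⟩⟩ :=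
    isPrimitiveRep_lcm_denom (minor K) ⟨0, Fin.elim0, Fin.elim0⟩
    (Matrix.det_fin_zero)
  have hinj := RatFunc.algebraMap_injective ℝ
  choose c x hc using exists_graphMinor_eq_minor K
  choose c' f hc' using exists_minor_eq_graphMinor K
  let v : (Fin m → Fin p ⊕ Fin m) → ℝ[X] := fun g => (c g : ℝ[X]) * u (x g)
  have hv : ∀ g, algebraMap ℝ[X] (RatFunc ℝ) (v g) = h * graphMinor K g := by
    intro g
    simp only [v, map_mul, hu, hc g, map_intCast]
    ring
  have huv : ∀ x, u x = (c' x : ℝ[X]) * v (f x) := by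
    intro x
    apply hinj
    rw [map_mul, hv, hu, hc' x, map_intCast]
    ring
  refine ⟨v, ⟨h, h0, hv⟩, ?_, ?_, ?_⟩
  · rw [eq_top_iff, ← hspan, Ideal.span_le]
    rintro _ ⟨z, rfl⟩
    rw [huv]
    exact Ideal.mul_mem_left _ _ (Ideal.subset_span ⟨_, rfl⟩)
  · intro g
    refine (natDegree_mul_le).trans ?_
    rw [natDegree_intCast, zero_add]
    exact hdeg _
  · refine ⟨f y, fun h => hy ?_⟩
    rw [mcMillanDegree] at h
    rw [huv, ← map_intCast (C : ℝ →+* ℝ[X]), coeff_C_mul, h, mul_zero]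

open Filter Topology

/-! ### Coefficientwise convergence of polynomials -/

/-- Coefficientwise convergence of real polynomials along a filter. -/
def CoeffTendsto {α : Type*} (l : Filter α) (p : α → ℝ[X]) (q : ℝ[X]) : Prop :=
  ∀ k, Tendsto (fun x => (p x).coeff k) l (𝓝 (q.coeff k))

namespace CoeffTendsto

variable {α : Type*} {l : Filter α} {p p' : α → ℝ[X]} {q q' : ℝ[X]}

theorem const (q : ℝ[X]) : CoeffTendsto l (fun _ => q) q := fun _ => tendsto_const_nhds

theorem comp {β : Type*} {l' : Filter β} {u : β → α} (h : CoeffTendsto l p q)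
    (hu : Tendsto u l' l) : CoeffTendsto l' (fun x => p (u x)) q := fun k => (h k).comp hu

theorem congr' (h : CoeffTendsto l p q) (hp : ∀ᶠ x in l, p x = p' x) : CoeffTendsto l p' q :=
  fun k => (h k).congr' (hp.mono fun x hx => by rw [hx])

theorem unique [l.NeBot] (h : CoeffTendsto l p q) (h' : CoeffTendsto l p q') : q = q' :=
  Polynomial.ext fun k => tendsto_nhds_unique (h k) (h' k)

theorem add (h : CoeffTendsto l p q) (h' : CoeffTendsto l p' q') :
    CoeffTendsto l (fun x => p x + p' x) (q + q') := fun k => by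
  simpa only [coeff_add] using (h k).add (h' k)

theorem sub (h : CoeffTendsto l p q) (h' : CoeffTendsto l p' q') :
    CoeffTendsto l (fun x => p x - p' x) (q - q') := fun k => by
  simpa only [coeff_sub] using (h k).sub (h' k)

theorem neg (h : CoeffTendsto l p q) : CoeffTendsto l (fun x => -p x) (-q) := fun k => by
  simpa only [coeff_neg] using (h k).neg

theorem mul (h : CoeffTendsto l p q) (h' : CoeffTendsto l p' q') :
    CoeffTendsto l (fun x => p x * p' x) (q * q') := fun k => by
  simp only [coeff_mul]
  exact tendsto_finsetSum _ fun i _ => (h _).mul (h' _)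

theorem sum {ι : Type*} {s : Finset ι} {p : ι → α → ℝ[X]} {q : ι → ℝ[X]}
    (h : ∀ i ∈ s, CoeffTendsto l (p i) (q i)) :
    CoeffTendsto l (fun x => ∑ i ∈ s, p i x) (∑ i ∈ s, q i) := fun k => by
  simp only [finsetSum_coeff]
  exact tendsto_finsetSum _ fun i hi => h i hi k

theorem prod {ι : Type*} {s : Finset ι} {p : ι → α → ℝ[X]} {q : ι → ℝ[X]}
    (h : ∀ i ∈ s, CoeffTendsto l (p i) (q i)) :
    CoeffTendsto l (fun x => ∏ i ∈ s, p i x) (∏ i ∈ s, q i) := by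
  classical
  induction s using Finset.induction_on with
  | empty => simpa using const 1
  | insert a s ha ih =>
    simp only [Finset.prod_insert ha]
    exact (h a (Finset.mem_insert_self a s)).mul
      (ih fun i hi => h i (Finset.mem_insert_of_mem hi))

theorem det {ι : Type*} [Fintype ι] [DecidableEq ι] {M : α → Matrix ι ι ℝ[X]}
    {N : Matrix ι ι ℝ[X]} (h : ∀ i j, CoeffTendsto l (fun x => M x i j) (N i j)) :
    CoeffTendsto l (fun x => (M x).det) N.det := by
  simp only [Matrix.det_apply']
  exact sum fun σ _ => (const _).mul (prod fun i _ => h _ _)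

end CoeffTendsto

/-! ### Bounds for polynomials on subsets of the complex plane -/

theorem norm_aeval_le {p : ℝ[X]} {N : ℕ} (hp : p.natDegree ≤ N) (z : ℂ) :
    ‖aeval z p‖ ≤ (∑ i ∈ Finset.range (N + 1), |p.coeff i|) * (1 + ‖z‖) ^ N := by
  rw [aeval_eq_sum_range' (Nat.lt_succ_of_le hp), Finset.sum_mul]
  refine norm_sum_le_of_le _ fun i hi => ?_
  rw [norm_smul, norm_pow, Real.norm_eq_abs]
  have h0 := norm_nonneg z
  gcongr
  calc ‖z‖ ^ i ≤ (1 + ‖z‖) ^ i := by gcongr; linarith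
    _ ≤ (1 + ‖z‖) ^ N := pow_le_pow_right₀ (by linarith) (by simpa [Nat.lt_succ_iff] using hi)

theorem norm_aeval_mul_le {p : ℝ[X]} {e : ℕ} (hp : p.degree < e) (z : ℂ) :
    ‖aeval z p‖ * (1 + ‖z‖) ≤ (∑ i ∈ Finset.range e, |p.coeff i|) * (1 + ‖z‖) ^ e := by
  have h0 := norm_nonneg z
  by_cases h : p = 0
  · simp only [h, map_zero, norm_zero, zero_mul]
    positivity
  rw [aeval_eq_sum_range' ((natDegree_lt_iff_degree_lt h).2 hp), Finset.sum_mul]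
  refine (mul_le_mul_of_nonneg_right (norm_sum_le _ _) (by linarith)).trans ?_
  rw [Finset.sum_mul]
  refine Finset.sum_le_sum fun i hi => ?_
  rw [norm_smul, norm_pow, Real.norm_eq_abs, mul_assoc]
  gcongr
  calc ‖z‖ ^ i * (1 + ‖z‖) ≤ (1 + ‖z‖) ^ i * (1 + ‖z‖) := by gcongr; linarith
    _ = (1 + ‖z‖) ^ (i + 1) := (pow_succ _ _).symm
    _ ≤ (1 + ‖z‖) ^ e := pow_le_pow_right₀ (by linarith) (by simpa using hi)

/-- A closed set stays at positive distance from each point outside it, so `‖z - w‖` dominates a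
multiple of `1 + ‖z‖`, both near `w` and at infinity. -/
theorem exists_le_norm_prod_sub {S : Set ℂ} (hS : IsClosed S) (s : Multiset ℂ)
    (hs : ∀ w ∈ s, w ∉ S) :
    ∃ c > 0, ∀ z ∈ S, c * (1 + ‖z‖) ^ s.card ≤ ‖(s.map fun w => z - w).prod‖ := by
  induction s using Multiset.induction_on with
  | empty => exact ⟨1, one_pos, fun z _ => by simp⟩
  | cons w s ih =>
    obtain ⟨c, hc, h⟩ := ih fun w hw => hs w (Multiset.mem_cons_of_mem hw)
    obtain ⟨δ, hδ, hball⟩ := Metric.isOpen_iff.1 hS.isOpen_compl w (hs w (Multiset.mem_cons_self w s))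
    have hz : ∀ z ∈ S, (1 + ‖z‖) ≤ ((1 + ‖w‖) / δ + 1) * ‖z - w‖ := by
      intro z hz
      have h1 : δ ≤ ‖z - w‖ := by
        by_contra! hlt
        exact hball (by simpa [dist_eq_norm] using hlt) hz
      have h2 : ‖z‖ ≤ ‖z - w‖ + ‖w‖ := by simpa using norm_add_le (z - w) w
      have h3 : 1 + ‖w‖ ≤ (1 + ‖w‖) / δ * ‖z - w‖ := by
        rw [div_mul_eq_mul_div, le_div_iff₀ hδ]
        gcongr
      linarith
    have hpos : 0 < (1 + ‖w‖) / δ + 1 := by positivity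
    refine ⟨c / ((1 + ‖w‖) / δ + 1), by positivity, fun z hzS => ?_⟩
    rw [Multiset.map_cons, Multiset.prod_cons, norm_mul, Multiset.card_cons, pow_succ]
    calc c / ((1 + ‖w‖) / δ + 1) * ((1 + ‖z‖) ^ s.card * (1 + ‖z‖))
        = (c * (1 + ‖z‖) ^ s.card) * ((1 + ‖z‖) / ((1 + ‖w‖) / δ + 1)) := by ring
      _ ≤ ‖(s.map fun w => z - w).prod‖ * ‖z - w‖ := by
        gcongr
        · exact h z hzS
        · rw [div_le_iff₀ hpos, mul_comm]
          exact hz z hzS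
      _ = _ := mul_comm _ _

/-- The complex roots of a real polynomial, with multiplicity. -/
noncomputable def complexRoots (q : ℝ[X]) : Multiset ℂ := (q.map (algebraMap ℝ ℂ)).roots

theorem aeval_eq_prod_complexRoots (q : ℝ[X]) (z : ℂ) :
    aeval z q = q.leadingCoeff * ((complexRoots q).map fun w => z - w).prod := by
  rw [← eval_map_algebraMap, (IsAlgClosed.splits _).eval_eq_prod_roots, leadingCoeff_map]
  rfl

theorem card_complexRoots (q : ℝ[X]) : (complexRoots q).card = q.natDegree := by
  rw [complexRoots, ← (IsAlgClosed.splits _).natDegree_eq_card_roots, natDegree_map]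

theorem aeval_eq_zero_of_mem_complexRoots {q : ℝ[X]} {w : ℂ} (hw : w ∈ complexRoots q) :
    aeval w q = 0 := by
  have := (mem_roots'.1 hw).2
  rwa [IsRoot, eval_map_algebraMap] at this

theorem exists_le_norm_aeval {S : Set ℂ} (hS : IsClosed S) {q : ℝ[X]} (hq : q ≠ 0)
    (h : ∀ z ∈ S, aeval z q ≠ 0) :
    ∃ c > 0, ∀ z ∈ S, c * (1 + ‖z‖) ^ q.natDegree ≤ ‖aeval z q‖ := by
  obtain ⟨c, hc, hb⟩ := exists_le_norm_prod_sub hS (complexRoots q)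
    fun w hw hwS => h w hwS (aeval_eq_zero_of_mem_complexRoots hw)
  have hl : 0 < ‖(q.leadingCoeff : ℂ)‖ := by simpa using hq
  refine ⟨‖(q.leadingCoeff : ℂ)‖ * c, by positivity, fun z hz => ?_⟩
  rw [aeval_eq_prod_complexRoots, norm_mul, mul_assoc, ← card_complexRoots]
  gcongr
  exact hb z hz

theorem pow_le_norm_prod_sub {z : ℂ} (hz : 0 ≤ z.re) (s : Multiset ℂ) (hs : ∀ w ∈ s, w.re < 0) :
    z.re ^ s.card ≤ ‖(s.map fun w => z - w).prod‖ := by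
  induction s using Multiset.induction_on with
  | empty => simp
  | cons w s ih =>
    rw [Multiset.map_cons, Multiset.prod_cons, norm_mul, Multiset.card_cons, pow_succ, mul_comm]
    have hw := hs w (Multiset.mem_cons_self w s)
    gcongr
    · calc z.re ≤ (z - w).re := by rw [Complex.sub_re]; linarith
        _ ≤ ‖z - w‖ := Complex.re_le_norm _
    · exact ih fun w hw => hs w (Multiset.mem_cons_of_mem hw)

/-- Every root lies at distance at least `z.re` from `z`. The bound depends on the leading
coefficient but not on the location of the roots, so it survives limits of stable polynomials. -/
theorem abs_leadingCoeff_mul_pow_le {q : ℝ[X]} (hq : ∀ z : ℂ, aeval z q = 0 → z.re < 0) {z : ℂ}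
    (hz : 0 ≤ z.re) : |q.leadingCoeff| * z.re ^ q.natDegree ≤ ‖aeval z q‖ := by
  rw [aeval_eq_prod_complexRoots, norm_mul, ← card_complexRoots, Complex.norm_real,
    Real.norm_eq_abs]
  gcongr
  exact pow_le_norm_prod_sub hz _ fun w hw => hq w (aeval_eq_zero_of_mem_complexRoots hw)

/-! ### Persistence of bounds and of unstable roots under perturbation. -/

section Limits

variable {α : Type*} {l : Filter α} {p : α → ℝ[X]} {q : ℝ[X]}

theorem CoeffTendsto.tendsto_aeval (h : CoeffTendsto l p q) {N : ℕ}
    (hp : ∀ᶠ x in l, (p x).natDegree ≤ N) (hq : q.natDegree ≤ N) (z : ℂ) :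
    Tendsto (fun x => aeval z (p x)) l (𝓝 (aeval z q)) := by
  have h1 : Tendsto (fun x => ∑ i ∈ Finset.range (N + 1), (p x).coeff i • z ^ i) l
      (𝓝 (aeval z q)) := by
    rw [aeval_eq_sum_range' (Nat.lt_succ_of_le hq)]
    exact tendsto_finsetSum _ fun i _ => (h i).smul_const _
  refine h1.congr' (hp.mono fun x hx => ?_)
  exact (aeval_eq_sum_range' (Nat.lt_succ_of_le hx) z).symm

/-- A lower bound of `exists_le_norm_aeval` persists under small perturbations of the
coefficients. -/
theorem CoeffTendsto.eventually_le_norm_aeval (h : CoeffTendsto l p q) {e : ℕ}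
    (hp : ∀ᶠ x in l, (p x).natDegree = e) (hq : q.natDegree = e) {S : Set ℂ} {c : ℝ} (hc : 0 < c)
    (hS : ∀ z ∈ S, c * (1 + ‖z‖) ^ e ≤ ‖aeval z q‖) :
    ∀ᶠ x in l, ∀ z ∈ S, c / 2 * (1 + ‖z‖) ^ e ≤ ‖aeval z (p x)‖ := by
  have h1 : Tendsto (fun x => ∑ i ∈ Finset.range (e + 1), |(p x - q).coeff i|) l (𝓝 0) := by
    have : Tendsto (fun x => ∑ i ∈ Finset.range (e + 1), |(p x - q).coeff i|) l
        (𝓝 (∑ i ∈ Finset.range (e + 1), |(q - q).coeff i|)) :=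
      tendsto_finsetSum _ fun i _ => ((h.sub (CoeffTendsto.const q)) i).abs
    simpa using this
  filter_upwards [hp, h1.eventually (gt_mem_nhds (half_pos hc))] with x hx hlt z hz
  have h2 := norm_aeval_le (p := p x - q) (N := e)
    ((natDegree_sub_le _ _).trans (by rw [hx, hq, max_self])) z
  have h3 := hS z hz
  rw [map_sub] at h2
  have h4 : ‖aeval z q‖ ≤ ‖aeval z (p x)‖ + ‖aeval z (p x) - aeval z q‖ := by
    rw [norm_sub_rev (aeval z (p x))]
    simpa using norm_add_le (aeval z (p x)) (aeval z q - aeval z (p x))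
  have h5 : (∑ i ∈ Finset.range (e + 1), |(p x - q).coeff i|) * (1 + ‖z‖) ^ e
      ≤ c / 2 * (1 + ‖z‖) ^ e := by gcongr
  linarith

theorem CoeffTendsto.eventually_norm_aeval_mul_le (h : CoeffTendsto l p q) {e : ℕ}
    (hp : ∀ᶠ x in l, (p x).degree < e) :
    ∃ M : ℝ, 0 ≤ M ∧ ∀ᶠ x in l, ∀ z : ℂ, ‖aeval z (p x)‖ * (1 + ‖z‖) ≤ M * (1 + ‖z‖) ^ e := by
  have h1 : Tendsto (fun x => ∑ i ∈ Finset.range e, |(p x).coeff i|) l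
      (𝓝 (∑ i ∈ Finset.range e, |q.coeff i|)) :=
    tendsto_finsetSum _ fun i _ => (h i).abs
  refine ⟨(∑ i ∈ Finset.range e, |q.coeff i|) + 1, by positivity, ?_⟩
  filter_upwards [hp, h1.eventually (gt_mem_nhds (lt_add_one _))] with x hx hlt z
  refine (norm_aeval_mul_le hx z).trans ?_
  gcongr

/-- Were the perturbed polynomials stable, `abs_leadingCoeff_mul_pow_le` would keep their values at
`z` away from `0`. Constant degree is essential: it makes the leading coefficients converge to a
nonzero number. -/
theorem CoeffTendsto.eventually_exists_root (h : CoeffTendsto l p q) {e : ℕ} (hq0 : q ≠ 0)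
    (hp : ∀ᶠ x in l, (p x).natDegree = e) (hq : q.natDegree = e) {z : ℂ} (hz : 0 < z.re)
    (hqz : aeval z q = 0) : ∀ᶠ x in l, ¬ ∀ w : ℂ, aeval w (p x) = 0 → w.re < 0 := by
  have h1 := (h.tendsto_aeval (hp.mono fun x hx => hx.le) hq.le z).norm
  have h2 : Tendsto (fun x => |(p x).coeff e| * z.re ^ e) l (𝓝 (|q.coeff e| * z.re ^ e)) :=
    (h e).abs.mul_const _
  have h3 : ‖aeval z q‖ < |q.coeff e| * z.re ^ e := by
    have : 0 < |q.coeff e| := by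
      rw [← hq]; simpa using hq0
    rw [hqz, norm_zero]
    positivity
  filter_upwards [hp, h1.eventually_lt h2 h3] with x hx hlt hst
  have := abs_leadingCoeff_mul_pow_le hst hz.le
  rw [leadingCoeff, hx] at this
  linarith

end Limits

/-! ### Transfer matrices over a common denominator -/

/-- `A = n / q` entrywise, `A` is strictly proper, and all roots of `q` are poles of `A`. -/
structure IsFractionRep {ι κ : Type} (A : TransferMatrix ι κ) (q : ℝ[X]) (n : ι → κ → ℝ[X]) :
    Prop where
  ne_zero : q ≠ 0
  eq_div : ∀ i j, A i j = algebraMap ℝ[X] (RatFunc ℝ) (n i j) / algebraMap ℝ[X] (RatFunc ℝ) q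
  degree_lt : ∀ i j, (n i j).degree < q.degree
  exists_pole : ∀ z : ℂ, aeval z q = 0 → ∃ i j, aeval z (A i j).denom = 0

/-- The integrand of the squared `H₂` norm, with values in `[0, ∞]`. -/
noncomputable def h2Density {ι κ : Type} [Fintype ι] [Fintype κ] (A : TransferMatrix ι κ) (ω : ℝ) :
    ℝ≥0∞ :=
  ENNReal.ofReal (h2Integrand A A ω).re

theorem evalAt_apply {ι κ : Type} (A : TransferMatrix ι κ) (z : ℂ) (i : ι) (j : κ) :
    evalAt A z i j = aeval z (A i j).num / aeval z (A i j).denom := rfl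

theorem measurable_evalAt {ι κ : Type} (A : TransferMatrix ι κ) (i : ι) (j : κ) :
    Measurable fun ω : ℝ => evalAt A (Complex.I * ω) i j := by
  simp only [evalAt_apply]
  have : ∀ q : ℝ[X], Measurable fun ω : ℝ => aeval (Complex.I * (ω : ℂ)) q := fun q =>
    (by fun_prop : Continuous fun ω : ℝ => aeval (Complex.I * (ω : ℂ)) q).measurable
  exact (this _).div (this _)

theorem finite_setOf_aeval_I_mul_eq_zero {q : ℝ[X]} (hq : q ≠ 0) :
    {ω : ℝ | aeval (Complex.I * (ω : ℂ)) q = 0}.Finite := by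
  have h1 : (q.map (algebraMap ℝ ℂ)) ≠ 0 :=
    (Polynomial.map_ne_zero_iff (algebraMap ℝ ℂ).injective).2 hq
  refine ((q.map (algebraMap ℝ ℂ)).roots.toFinset.finite_toSet.preimage
    (f := fun ω : ℝ => Complex.I * (ω : ℂ)) ?_).subset ?_
  · intro a _ b _ hab
    simpa using hab
  · intro ω hω
    simp only [Set.mem_preimage, Finset.mem_coe, Multiset.mem_toFinset, mem_roots h1, IsRoot,
      eval_map_algebraMap]
    exact hω

/-! ### The `H₂` density and its divergence at imaginary poles. -/

section Density

variable {ι κ : Type} [Fintype ι] [Fintype κ]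

theorem h2Density_eq (A : TransferMatrix ι κ) (ω : ℝ) :
    h2Density A ω = ENNReal.ofReal (∑ i, ∑ j, ‖evalAt A (Complex.I * ω) i j‖ ^ 2) := by
  rw [h2Density, h2Integrand_self, Complex.ofReal_re]

theorem measurable_sum_sq_norm (A : TransferMatrix ι κ) :
    Measurable fun ω : ℝ => ∑ i, ∑ j, ‖evalAt A (Complex.I * ω) i j‖ ^ 2 :=
  Finset.measurable_sum _ fun i _ => Finset.measurable_sum _ fun j _ =>
    (measurable_evalAt A i j).norm.pow_const 2

theorem measurable_h2Density (A : TransferMatrix ι κ) : Measurable (h2Density A) := by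
  simp only [funext (h2Density_eq A)]
  exact (measurable_sum_sq_norm A).ennreal_ofReal

theorem h2NormSq_eq_of_isStable {A : TransferMatrix ι κ} (h : IsStable A) :
    h2NormSq A = ENNReal.ofReal (1 / (2 * Real.pi)) * ∫⁻ ω, h2Density A ω := by
  rw [h2NormSq, if_pos h]
  rfl

theorem h2NormSq_eq_top {A : TransferMatrix ι κ} (h : ¬ IsStable A) : h2NormSq A = ∞ := by
  rw [h2NormSq, if_neg h]

theorem lintegral_h2Density_le (A : TransferMatrix ι κ) :
    ENNReal.ofReal (1 / (2 * Real.pi)) * ∫⁻ ω, h2Density A ω ≤ h2NormSq A := by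
  by_cases h : IsStable A
  · rw [h2NormSq_eq_of_isStable h]
  · rw [h2NormSq_eq_top h]
    exact le_top

/-- A pole on the imaginary axis makes the integral infinite. -/
theorem lintegral_h2Density_eq_top {A : TransferMatrix ι κ} {i : ι} {j : κ} {ω₀ : ℝ}
    (h : aeval (Complex.I * (ω₀ : ℂ)) (A i j).denom = 0) : ∫⁻ ω, h2Density A ω = ∞ := by
  by_contra hfin
  set g : ℝ → ℝ := fun ω => ∑ i, ∑ j, ‖evalAt A (Complex.I * ω) i j‖ ^ 2 with hg
  have hg0 : ∀ ω, 0 ≤ g ω := fun ω => by positivity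
  have hint : Integrable g := by
    refine ⟨(measurable_sum_sq_norm A).aestronglyMeasurable, ?_⟩
    rw [hasFiniteIntegral_iff_ofReal (ae_of_all _ hg0)]
    simp only [funext (h2Density_eq A)] at hfin
    exact lt_top_iff_ne_top.2 hfin
  set z₀ : ℂ := Complex.I * (ω₀ : ℂ) with hz₀
  have hnum : aeval z₀ (A i j).num ≠ 0 := by
    intro hn
    obtain ⟨a, b, hab⟩ := RatFunc.isCoprime_num_denom (A i j)
    have := congrArg (aeval z₀) hab
    simp [hn, h] at this
  obtain ⟨r, hr⟩ : X - C z₀ ∣ (A i j).denom.map (algebraMap ℝ ℂ) := by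
    rw [dvd_iff_isRoot, IsRoot, eval_map_algebraMap]
    exact h
  have hden : ∀ z : ℂ, aeval z (A i j).denom = (z - z₀) * eval z r := by
    intro z
    rw [← eval_map_algebraMap, hr]
    simp
  have hc1 : Continuous fun ω : ℝ => aeval (Complex.I * (ω : ℂ)) (A i j).num := by fun_prop
  have hc2 : Continuous fun ω : ℝ => eval (Complex.I * (ω : ℂ)) r := by fun_prop
  have hnb : ∀ᶠ ω : ℝ in 𝓝 ω₀,
      ‖aeval z₀ (A i j).num‖ / 2 < ‖aeval (Complex.I * (ω : ℂ)) (A i j).num‖ :=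
    hc1.norm.continuousAt.eventually (lt_mem_nhds (half_lt_self (norm_pos_iff.2 hnum)))
  have hrb : ∀ᶠ ω : ℝ in 𝓝 ω₀, ‖eval (Complex.I * (ω : ℂ)) r‖ < ‖eval z₀ r‖ + 1 :=
    hc2.norm.continuousAt.eventually (gt_mem_nhds (lt_add_one _))
  have hball : ∀ᶠ ω : ℝ in 𝓝 ω₀, |ω - ω₀| < 1 := by
    filter_upwards [Metric.ball_mem_nhds ω₀ one_pos] with ω hω
    simpa [Real.dist_eq] using hω
  have hfinite := finite_setOf_aeval_I_mul_eq_zero (RatFunc.denom_ne_zero (A i j))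
  -- Division by zero gives the value `0` at a zero of the denominator, so any other such zeros have
  -- to be kept away.
  have hne : ∀ᶠ ω : ℝ in 𝓝[≠] ω₀, aeval (Complex.I * (ω : ℂ)) (A i j).denom ≠ 0 := by
    have h1 := (hfinite.subset (Set.sdiff_subset (t := {ω₀}))).isClosed.isOpen_compl.mem_nhds
      (x := ω₀) (by simp)
    filter_upwards [mem_nhdsWithin_of_mem_nhds h1, self_mem_nhdsWithin] with ω h2 h3 h4
    exact h2 ⟨h4, h3⟩
  set δ := ‖aeval z₀ (A i j).num‖ / 2 with hδ
  have hδ0 : 0 < δ := half_pos (norm_pos_iff.2 hnum)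
  set M := ‖eval z₀ r‖ + 1 with hM
  have hM0 : 0 < M := by positivity
  -- The density grows at least like `(ω - ω₀)⁻²`; the weaker first-power bound already excludes
  -- integrability.
  have hO : (fun ω => (ω - ω₀)⁻¹) =O[𝓝[≠] ω₀] g := by
    refine Asymptotics.IsBigO.of_bound (M ^ 2 / δ ^ 2) ?_
    filter_upwards [mem_nhdsWithin_of_mem_nhds hnb, mem_nhdsWithin_of_mem_nhds hrb,
      mem_nhdsWithin_of_mem_nhds hball, hne, self_mem_nhdsWithin] with ω h1 h2 h3 h4 h5
    have h6 : ‖evalAt A (Complex.I * ω) i j‖ ^ 2 ≤ g ω := by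
      refine le_trans ?_ (Finset.single_le_sum (f := fun i =>
        ∑ j, ‖evalAt A (Complex.I * ω) i j‖ ^ 2) (fun _ _ => by positivity) (Finset.mem_univ i))
      exact Finset.single_le_sum (f := fun j => ‖evalAt A (Complex.I * ω) i j‖ ^ 2)
        (fun _ _ => by positivity) (Finset.mem_univ j)
    have h7 : 0 < |ω - ω₀| := abs_pos.2 (sub_ne_zero.2 h5)
    have h8 : ‖aeval (Complex.I * (ω : ℂ)) (A i j).denom‖
        = |ω - ω₀| * ‖eval (Complex.I * (ω : ℂ)) r‖ := by
      rw [hden, norm_mul, hz₀, ← mul_sub, norm_mul, Complex.norm_I, one_mul, ← Complex.ofReal_sub,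
        Complex.norm_real, Real.norm_eq_abs]
    have h9 : 0 < ‖aeval (Complex.I * (ω : ℂ)) (A i j).denom‖ := norm_pos_iff.2 h4
    have h10 : ‖aeval (Complex.I * (ω : ℂ)) (A i j).denom‖ ^ 2 ≤ |ω - ω₀| * M ^ 2 := by
      rw [h8, mul_pow]
      calc |ω - ω₀| ^ 2 * ‖eval (Complex.I * (ω : ℂ)) r‖ ^ 2
          ≤ |ω - ω₀| ^ 1 * M ^ 2 := by
            gcongr ?_ * ?_ ^ 2
            exact pow_le_pow_of_le_one h7.le h3.le one_le_two
        _ = |ω - ω₀| * M ^ 2 := by rw [pow_one]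
    rw [norm_inv, Real.norm_eq_abs, Real.norm_of_nonneg (hg0 ω)]
    calc |ω - ω₀|⁻¹ = M ^ 2 / δ ^ 2 * (δ ^ 2 / (|ω - ω₀| * M ^ 2)) := by
          field_simp
      _ ≤ M ^ 2 / δ ^ 2 * (‖aeval (Complex.I * (ω : ℂ)) (A i j).num‖ ^ 2
            / ‖aeval (Complex.I * (ω : ℂ)) (A i j).denom‖ ^ 2) := by
          gcongr
      _ = M ^ 2 / δ ^ 2 * ‖evalAt A (Complex.I * ω) i j‖ ^ 2 := by
          rw [evalAt_apply, norm_div]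
          congr 1
          rw [div_pow]
      _ ≤ M ^ 2 / δ ^ 2 * g ω := by gcongr
  exact not_intervalIntegrable_of_sub_inv_isBigO_punctured (b := ω₀ + 1) hO (by simp)
    Set.left_mem_uIcc hint.intervalIntegrable

end Density

namespace IsFractionRep

variable {ι κ : Type} {A : TransferMatrix ι κ} {q : ℝ[X]} {n : ι → κ → ℝ[X]}

theorem denom_dvd (h : IsFractionRep A q n) (i : ι) (j : κ) : (A i j).denom ∣ q :=
  (RatFunc.denom_dvd h.ne_zero).2 ⟨_, h.eq_div i j⟩

theorem aeval_denom_ne_zero (h : IsFractionRep A q n) {z : ℂ} (hz : aeval z q ≠ 0) (i : ι)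
    (j : κ) : aeval z (A i j).denom ≠ 0 := by
  obtain ⟨t, ht⟩ := h.denom_dvd i j
  intro h0
  exact hz (by rw [ht, map_mul, h0, zero_mul])

theorem isStable_iff (h : IsFractionRep A q n) :
    IsStable A ↔ ∀ z : ℂ, aeval z q = 0 → z.re < 0 := by
  constructor
  · intro hA z hz
    obtain ⟨i, j, hij⟩ := h.exists_pole z hz
    exact hA i j z hij
  · intro hq i j z hz
    by_contra hre
    exact h.aeval_denom_ne_zero (fun h0 => hre (hq z h0)) i j hz

theorem evalAt_eq (h : IsFractionRep A q n) {z : ℂ} (hz : aeval z q ≠ 0)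
    (i : ι) (j : κ) : evalAt A z i j = aeval z (n i j) / aeval z q := by
  rw [evalAt_apply, div_eq_div_iff (h.aeval_denom_ne_zero hz i j) hz, ← map_mul, ← map_mul,
    (RatFunc.num_mul_eq_mul_denom_iff h.ne_zero).2 (h.eq_div i j)]

end IsFractionRep

/-! ### Convergence of the `H₂` norm -/

section Convergence

variable {α : Type*} {l : Filter α} {ι κ : Type} [Fintype ι] [Fintype κ]
  {A : α → TransferMatrix ι κ} {q : α → ℝ[X]} {n : α → ι → κ → ℝ[X]}
  {A' : TransferMatrix ι κ} {q' : ℝ[X]} {n' : ι → κ → ℝ[X]} {e : ℕ}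

/-- Only the finitely many imaginary roots of `q'` are excluded. Stability plays no role, so this
serves both dominated convergence and Fatou's lemma. -/
theorem tendsto_h2Density (hA : ∀ᶠ x in l, IsFractionRep (A x) (q x) (n x))
    (hA' : IsFractionRep A' q' n') (hq : CoeffTendsto l q q')
    (hn : ∀ i j, CoeffTendsto l (fun x => n x i j) (n' i j))
    (he : ∀ᶠ x in l, (q x).natDegree = e) (he' : q'.natDegree = e) :
    ∀ᵐ ω : ℝ, Tendsto (fun x => h2Density (A x) ω) l (𝓝 (h2Density A' ω)) := by
  have hfin := (finite_setOf_aeval_I_mul_eq_zero hA'.ne_zero).measure_zero volume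
  filter_upwards [compl_mem_ae_iff.2 hfin] with ω hω
  replace hω : aeval (Complex.I * (ω : ℂ)) q' ≠ 0 := hω
  have h1 := hq.tendsto_aeval (he.mono fun x hx => hx.le) he'.le (Complex.I * (ω : ℂ))
  have h2 : ∀ i j, Tendsto (fun x => aeval (Complex.I * (ω : ℂ)) (n x i j)) l
      (𝓝 (aeval (Complex.I * (ω : ℂ)) (n' i j))) := fun i j => by
    refine (hn i j).tendsto_aeval (N := e) ?_ ?_ _
    · filter_upwards [hA, he] with x hx hex
      rw [← hex]
      exact natDegree_le_natDegree (hx.degree_lt i j).le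
    · rw [← he']
      exact natDegree_le_natDegree (hA'.degree_lt i j).le
  simp only [h2Density_eq]
  refine ENNReal.tendsto_ofReal (tendsto_finsetSum _ fun i _ => tendsto_finsetSum _ fun j _ => ?_)
  rw [hA'.evalAt_eq hω]
  refine (Tendsto.congr' ?_ ((h2 i j).div h1 hω)).norm.pow 2
  filter_upwards [hA, h1.eventually_ne hω] with x hx hne
  exact (hx.evalAt_eq hne i j).symm

/-- A single lower bound for `q` on the closed right half-plane does two things: it makes nearby
systems stable, and with the degree gap between `n` and `q` it yields the integrable majorant `B /
(1 + ω²)`. -/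
theorem tendsto_h2NormSq_of_isStable [l.IsCountablyGenerated]
    (hA : ∀ᶠ x in l, IsFractionRep (A x) (q x) (n x))
    (hA' : IsFractionRep A' q' n') (hq : CoeffTendsto l q q')
    (hn : ∀ i j, CoeffTendsto l (fun x => n x i j) (n' i j))
    (he : ∀ᶠ x in l, (q x).natDegree = e) (he' : q'.natDegree = e) (hst : IsStable A') :
    Tendsto (fun x => h2NormSq (A x)) l (𝓝 (h2NormSq A')) := by
  have hlim := tendsto_h2Density hA hA' hq hn he he'
  have hclosed : IsClosed {z : ℂ | 0 ≤ z.re} := isClosed_le continuous_const Complex.continuous_re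
  obtain ⟨c, hc, hb⟩ := exists_le_norm_aeval hclosed hA'.ne_zero
    fun z (hz : 0 ≤ z.re) h0 => (hA'.isStable_iff.1 hst z h0).not_ge hz
  rw [he'] at hb
  have hlow := hq.eventually_le_norm_aeval he he' hc hb
  have hstab : ∀ᶠ x in l, IsStable (A x) := by
    filter_upwards [hA, hlow] with x hx hx'
    rw [hx.isStable_iff]
    intro z hz
    by_contra! hre
    have h1 := hx' z hre
    rw [hz, norm_zero] at h1
    have h2 : 0 < c / 2 * (1 + ‖z‖) ^ e := by positivity
    linarith
  have hup : ∀ i j, ∃ M : ℝ, 0 ≤ M ∧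
      ∀ᶠ x in l, ∀ z : ℂ, ‖aeval z (n x i j)‖ * (1 + ‖z‖) ≤ M * (1 + ‖z‖) ^ e := fun i j => by
    refine (hn i j).eventually_norm_aeval_mul_le ?_
    filter_upwards [hA, he] with x hx hex
    rw [← hex, ← degree_eq_natDegree hx.ne_zero]
    exact hx.degree_lt i j
  choose M hM0 hM using hup
  have hM' : ∀ᶠ x in l, ∀ i j, ∀ z : ℂ,
      ‖aeval z (n x i j)‖ * (1 + ‖z‖) ≤ M i j * (1 + ‖z‖) ^ e :=
    eventually_all.2 fun i => eventually_all.2 fun j => hM i j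
  set B : ℝ := ∑ i, ∑ j, (M i j / (c / 2)) ^ 2 with hB
  have hbound : ∀ᶠ x in l, ∀ᵐ ω : ℝ,
      h2Density (A x) ω ≤ ENNReal.ofReal (B * (1 + ω ^ 2)⁻¹) := by
    filter_upwards [hA, hlow, hM'] with x hx hlx hMx
    refine ae_of_all _ fun ω => ?_
    rw [h2Density_eq]
    refine ENNReal.ofReal_le_ofReal ?_
    rw [hB, Finset.sum_mul]
    refine Finset.sum_le_sum fun i _ => ?_
    rw [Finset.sum_mul]
    refine Finset.sum_le_sum fun j _ => ?_
    set z : ℂ := Complex.I * (ω : ℂ) with hz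
    have hzn : ‖z‖ = |ω| := by simp [hz]
    have h1 := hlx z (by simp [hz])
    have h2 := hMx i j z
    have h3 : 0 < 1 + ‖z‖ := by positivity
    have h4 : 0 < c / 2 * (1 + ‖z‖) ^ e := by positivity
    have h5 : aeval z (q x) ≠ 0 := norm_pos_iff.1 (h4.trans_le h1)
    rw [hx.evalAt_eq h5, norm_div]
    have h6 : ‖aeval z (n x i j)‖ / ‖aeval z (q x)‖ ≤ M i j / (c / 2) * (1 + ‖z‖)⁻¹ := by
      calc ‖aeval z (n x i j)‖ / ‖aeval z (q x)‖
          ≤ (M i j * (1 + ‖z‖) ^ e / (1 + ‖z‖)) / (c / 2 * (1 + ‖z‖) ^ e) := by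
            gcongr
            · have := hM0 i j
              positivity
            · rwa [le_div_iff₀ h3]
        _ = M i j / (c / 2) * (1 + ‖z‖)⁻¹ := by
            field_simp
    calc (‖aeval z (n x i j)‖ / ‖aeval z (q x)‖) ^ 2
        ≤ (M i j / (c / 2) * (1 + ‖z‖)⁻¹) ^ 2 := by gcongr
      _ = (M i j / (c / 2)) ^ 2 * ((1 + ‖z‖) ^ 2)⁻¹ := by rw [mul_pow, inv_pow]
      _ ≤ (M i j / (c / 2)) ^ 2 * (1 + ω ^ 2)⁻¹ := by
        gcongr
        rw [hzn, ← sq_abs ω]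
        nlinarith [abs_nonneg ω]
  have hfin : ∫⁻ ω : ℝ, ENNReal.ofReal (B * (1 + ω ^ 2)⁻¹) ≠ ∞ := by
    have h1 : Integrable fun ω : ℝ => B * (1 + ω ^ 2)⁻¹ := integrable_inv_one_add_sq.const_mul B
    exact h1.lintegral_lt_top.ne
  have hmain := tendsto_lintegral_filter_of_dominated_convergence _
    (Eventually.of_forall fun x => measurable_h2Density (A x)) hbound hfin hlim
  rw [h2NormSq_eq_of_isStable hst]
  refine (ENNReal.Tendsto.const_mul hmain (Or.inr ENNReal.ofReal_ne_top)).congr' ?_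
  filter_upwards [hstab] with x hx
  exact (h2NormSq_eq_of_isStable hx).symm

theorem tendsto_h2NormSq [l.IsCountablyGenerated]
    (hA : ∀ᶠ x in l, IsFractionRep (A x) (q x) (n x))
    (hA' : IsFractionRep A' q' n') (hq : CoeffTendsto l q q')
    (hn : ∀ i j, CoeffTendsto l (fun x => n x i j) (n' i j))
    (he : ∀ᶠ x in l, (q x).natDegree = e) (he' : q'.natDegree = e) :
    Tendsto (fun x => h2NormSq (A x)) l (𝓝 (h2NormSq A')) := by
  by_cases hst : IsStable A'
  · exact tendsto_h2NormSq_of_isStable hA hA' hq hn he he' hst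
  rw [h2NormSq_eq_top hst]
  rw [hA'.isStable_iff] at hst
  push Not at hst
  obtain ⟨z, hz, hre⟩ := hst
  rcases hre.lt_or_eq with hre | hre
  · refine tendsto_const_nhds.congr' ?_
    filter_upwards [hA, hq.eventually_exists_root hA'.ne_zero he he' hre hz] with x hx hx'
    exact (h2NormSq_eq_top fun h => hx' (hx.isStable_iff.1 h)).symm
  · obtain ⟨i, j, hij⟩ := hA'.exists_pole z hz
    have hzI : z = Complex.I * (z.im : ℂ) := by
      apply Complex.ext <;> simp [← hre]
    rw [hzI] at hij
    have htop := lintegral_h2Density_eq_top hij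
    have hlim := tendsto_h2Density hA hA' hq hn he he'
    rcases l.eq_or_neBot with rfl | hl
    · exact tendsto_bot
    -- Fatou's lemma. Nearby systems may be stable or not; in both cases the integral bounds
    -- `h2NormSq` from below.
    have h1 : ∞ ≤ liminf (fun x => ∫⁻ ω, h2Density (A x) ω) l := by
      rw [← htop, lintegral_congr_ae (hlim.mono fun ω h => h.liminf_eq.symm)]
      exact lintegral_liminf_le fun x => measurable_h2Density (A x)
    have h2 : Tendsto (fun x => ∫⁻ ω, h2Density (A x) ω) l (𝓝 ∞) :=
      tendsto_of_le_liminf_of_limsup_le h1 le_top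
    have h3 : Tendsto (fun x => ENNReal.ofReal (1 / (2 * Real.pi)) * ∫⁻ ω, h2Density (A x) ω) l
        (𝓝 ∞) := by
      have h4 : ENNReal.ofReal (1 / (2 * Real.pi)) ≠ 0 := by
        rw [Ne, ENNReal.ofReal_eq_zero, not_le]
        positivity
      have := ENNReal.Tendsto.const_mul h2 (Or.inr (ENNReal.ofReal_ne_top (r := 1 / (2 * Real.pi))))
      rwa [ENNReal.mul_top h4] at this
    exact tendsto_nhds_top_mono h3 (Eventually.of_forall fun x => lintegral_h2Density_le (A x))

end Convergence

/-! ### The characteristic polynomial of the loop -/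

/-- The maximal minors of `[P; 1]`. -/
def basisMinor {F : Type*} [Field F] {m p : ℕ} (P : Matrix (Fin p) (Fin m) F)
    (g : Fin m → Fin p ⊕ Fin m) : F :=
  ((graphBasis P).submatrix g id).det

theorem basisMinor_inr {F : Type*} [Field F] {m p : ℕ} (P : Matrix (Fin p) (Fin m) F) :
    basisMinor P Sum.inr = 1 := by
  have : (graphBasis P).submatrix Sum.inr id = 1 := by
    ext i j
    simp [graphBasis]
  rw [basisMinor, this, Matrix.det_one]

/-- The embedding of the real constants into the field of rational functions. -/
noncomputable def constHom : ℝ →+* RatFunc ℝ := (algebraMap ℝ[X] (RatFunc ℝ)).comp C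

/-- For polynomial multiples `v`, `w` of the maximal minors of `[-K, 1]` and `[P; 1]`, the
corresponding multiple of `det ([-K, 1] X [P; 1])`. -/
noncomputable def pairing {m p : ℕ} (X : Matrix (Fin p ⊕ Fin m) (Fin p ⊕ Fin m) ℝ)
    (v w : (Fin m → Fin p ⊕ Fin m) → ℝ[X]) : ℝ[X] :=
  C (((m.factorial : ℝ) ^ 2)⁻¹) * ∑ f, ∑ g, C (X.submatrix f g).det * (v f * w g)

section Pairing

variable {m p : ℕ} (X : Matrix (Fin p ⊕ Fin m) (Fin p ⊕ Fin m) ℝ)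

theorem natDegree_pairing_le {v w : (Fin m → Fin p ⊕ Fin m) → ℝ[X]} {d δ : ℕ}
    (hv : ∀ f, (v f).natDegree ≤ d) (hw : ∀ g, (w g).natDegree ≤ δ) :
    (pairing X v w).natDegree ≤ d + δ := by
  refine (natDegree_C_mul_le _ _).trans ?_
  refine natDegree_sum_le_of_forall_le _ _ fun f _ =>
    natDegree_sum_le_of_forall_le _ _ fun g _ => ?_
  exact (natDegree_C_mul_le _ _).trans (natDegree_mul_le.trans (add_le_add (hv f) (hw g)))

theorem CoeffTendsto.pairing {α : Type*} {l : Filter α}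
    {v : α → (Fin m → Fin p ⊕ Fin m) → ℝ[X]} {v' : (Fin m → Fin p ⊕ Fin m) → ℝ[X]}
    (hv : ∀ f, CoeffTendsto l (fun x => v x f) (v' f)) (w : (Fin m → Fin p ⊕ Fin m) → ℝ[X]) :
    CoeffTendsto l (fun x => HTwoCost.pairing X (v x) w) (HTwoCost.pairing X v' w) :=
  (const _).mul (sum fun f _ => sum fun _ _ => (const _).mul ((hv f).mul (const _)))

/-- Cauchy–Binet is applied twice, and each use leaves a factor `m!`. The matrix `X` is inserted so
that one formula covers both the denominator (`X = 1`) and the numerators (`X` an elementary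
perturbation of `1`). -/
theorem algebraMap_pairing {K : TransferMatrix (Fin m) (Fin p)} {P : TransferMatrix (Fin p) (Fin m)}
    {v w : (Fin m → Fin p ⊕ Fin m) → ℝ[X]} {h k : RatFunc ℝ}
    (hv : ∀ f, algebraMap ℝ[X] (RatFunc ℝ) (v f) = h * graphMinor K f)
    (hw : ∀ g, algebraMap ℝ[X] (RatFunc ℝ) (w g) = k * basisMinor P g) :
    algebraMap ℝ[X] (RatFunc ℝ) (pairing X v w)
      = h * k * (graphAnnihilator K * (X.map constHom * graphBasis P)).det := by
  have hm : (m.factorial : RatFunc ℝ) ≠ 0 := Nat.cast_ne_zero.2 m.factorial_ne_zero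
  have h1 : ∀ f : Fin m → Fin p ⊕ Fin m,
      (m.factorial : RatFunc ℝ) * ((X.map constHom * graphBasis P).submatrix f id).det
        = ∑ g, constHom (X.submatrix f g).det * basisMinor P g := by
    intro f
    have e : (X.map constHom * graphBasis P).submatrix f id
        = (X.map constHom).submatrix f id * graphBasis P := by
      ext i j
      simp [Matrix.mul_apply]
    rw [e, factorial_mul_det_mul]
    refine Finset.sum_congr rfl fun g _ => ?_
    rw [RingHom.map_det]
    rfl
  have h2 : (m.factorial : RatFunc ℝ) ^ 2
      * (graphAnnihilator K * (X.map constHom * graphBasis P)).det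
        = ∑ f, ∑ g, graphMinor K f * (constHom (X.submatrix f g).det * basisMinor P g) := by
    rw [sq, mul_assoc, factorial_mul_det_mul, Finset.mul_sum]
    refine Finset.sum_congr rfl fun f _ => ?_
    rw [← Finset.mul_sum, ← h1]
    simp only [graphMinor]
    ring
  have h3 : algebraMap ℝ[X] (RatFunc ℝ) (pairing X v w)
      = ((m.factorial : RatFunc ℝ) ^ 2)⁻¹ * (h * k * ∑ f, ∑ g,
          graphMinor K f * (constHom (X.submatrix f g).det * basisMinor P g)) := by
    have h4 : algebraMap ℝ[X] (RatFunc ℝ) (C (((m.factorial : ℝ) ^ 2)⁻¹))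
        = ((m.factorial : RatFunc ℝ) ^ 2)⁻¹ := by
      change constHom _ = _
      rw [map_inv₀, map_pow, map_natCast]
    simp only [pairing, map_mul, map_sum, h4, hv, hw, Finset.mul_sum]
    refine Finset.sum_congr rfl fun f _ => Finset.sum_congr rfl fun g _ => ?_
    change _ * (constHom _ * _) = _
    ring
  rw [h3, ← h2]
  field_simp

end Pairing

/-! ### The closed loop in terms of `Q = [P; 1] (1 - K P)⁻¹ [-K, 1]` -/

section Loop

variable {p m : ℕ} {P : TransferMatrix (Fin p) (Fin m)} {K : TransferMatrix (Fin m) (Fin p)}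
  {G : TransferMatrix (Fin p ⊕ Fin m) (Fin p ⊕ Fin m)}

/-- The projection onto the graph of `P` along the graph of `K`. -/
noncomputable def loopProjection (P : TransferMatrix (Fin p) (Fin m))
    (K : TransferMatrix (Fin m) (Fin p)) : TransferMatrix (Fin p ⊕ Fin m) (Fin p ⊕ Fin m) :=
  graphBasis P * (graphAnnihilator K * graphBasis P)⁻¹ * graphAnnihilator K

/-- Signs relating `G` to `loopProjection`. -/
def loopSign (p m : ℕ) : Fin p ⊕ Fin m → ℝ := Sum.elim (fun _ => -1) fun _ => 1

/-- Constant terms relating `G` to `loopProjection`. -/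
noncomputable def loopShift (p m : ℕ) : Matrix (Fin p ⊕ Fin m) (Fin p ⊕ Fin m) ℝ :=
  Matrix.fromBlocks 1 0 0 0

open Matrix in
theorem IsFeedbackInterconnection.mul_eq_one (hG : IsFeedbackInterconnection P K G) :
    fromBlocks 1 (-P) (-K) 1 * G = 1 := by
  refine Matrix.mulVec_injective (funext fun u => ?_)
  rw [← Matrix.mulVec_mulVec, Matrix.one_mulVec]
  set y := G *ᵥ u with hy
  have h := (hG (u ∘ Sum.inl) (y ∘ Sum.inl) (u ∘ Sum.inr) (y ∘ Sum.inr)).2 (by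
    rw [Sum.elim_comp_inl_inr, Sum.elim_comp_inl_inr])
  obtain ⟨h1, h2⟩ := h
  rw [← Sum.elim_comp_inl_inr y, fromBlocks_mulVec, ← Sum.elim_comp_inl_inr u]
  simp only [Sum.elim_comp_inl, Sum.elim_comp_inr, one_mulVec, neg_mulVec]
  congr 1
  · rw [← sub_eq_add_neg, sub_eq_iff_eq_add]
    exact h1
  · rw [neg_add_eq_sub, sub_eq_iff_eq_add]
    exact h2

open Matrix in
theorem IsFeedbackInterconnection.det_ne_zero (hG : IsFeedbackInterconnection P K G) :
    (graphAnnihilator K * graphBasis P).det ≠ 0 := by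
  have h := congrArg det hG.mul_eq_one
  rw [det_mul, det_one, det_fromBlocks_one₁₁, Matrix.neg_mul, Matrix.mul_neg, neg_neg,
    ← graphAnnihilator_mul_graphBasis] at h
  exact left_ne_zero_of_mul_eq_one h

-- Both sides have the same product with the invertible loop matrix `[1, -P; -K, 1]`, namely `[0;
-- [-K, 1]]`.
open Matrix in
theorem IsFeedbackInterconnection.loopProjection_eq (hG : IsFeedbackInterconnection P K G)
    (i j : Fin p ⊕ Fin m) :
    loopProjection P K i j = constHom (loopSign p m j) * G i j + constHom (loopShift p m i j) := by
  have hu : IsUnit (graphAnnihilator K * graphBasis P).det := isUnit_iff_ne_zero.2 hG.det_ne_zero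
  have hM := hG.mul_eq_one
  have hM' : G * fromBlocks 1 (-P) (-K) 1 = 1 := mul_eq_one_comm.1 hM
  let J : TransferMatrix (Fin p ⊕ Fin m) (Fin p ⊕ Fin m) := fromBlocks (-1) 0 0 1
  let T : TransferMatrix (Fin p ⊕ Fin m) (Fin p ⊕ Fin m) := fromBlocks 1 0 0 0
  have h1 : fromBlocks 1 (-P) (-K) 1 * graphBasis P
      = fromRows 0 (graphAnnihilator K * graphBasis P) := by
    rw [graphAnnihilator_mul_graphBasis, graphBasis, fromBlocks_mul_fromRows]
    simp [sub_eq_add_neg, add_comm]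
  have h2 : fromBlocks 1 (-P) (-K) 1 * loopProjection P K = fromRows 0 (graphAnnihilator K) := by
    rw [loopProjection, ← Matrix.mul_assoc, ← Matrix.mul_assoc, h1, fromRows_mul, fromRows_mul,
      mul_nonsing_inv _ hu]
    simp
  have h3 : fromBlocks 1 (-P) (-K) 1 * (G * J + T) = fromRows 0 (graphAnnihilator K) := by
    rw [Matrix.mul_add, ← Matrix.mul_assoc, hM, Matrix.one_mul, fromBlocks_multiply,
      fromBlocks_add, graphAnnihilator]
    ext a b
    rcases a with a | a <;> rcases b with b | b <;> simp
  have h4 : loopProjection P K = G * J + T := by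
    have := congrArg (G * ·) (h2.trans h3.symm)
    simpa only [← Matrix.mul_assoc, hM', Matrix.one_mul] using this
  have hJ : J = diagonal fun j => constHom (loopSign p m j) := by
    ext a b
    rcases a with a | a <;> rcases b with b | b <;>
      simp only [J, loopSign, fromBlocks_apply₁₁, fromBlocks_apply₁₂, fromBlocks_apply₂₁,
        fromBlocks_apply₂₂, Matrix.neg_apply, Matrix.zero_apply, Matrix.one_apply,
        diagonal_apply] <;>
      split_ifs <;> simp_all
  rw [h4, hJ, Matrix.add_apply, mul_diagonal, mul_comm]
  congr 1
  rcases i with i | i <;> rcases j with j | j <;>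
    simp [T, loopShift, one_apply, apply_ite constHom]

theorem loopSign_mul_self (j : Fin p ⊕ Fin m) : loopSign p m j * loopSign p m j = 1 := by
  rcases j with j | j <;> simp [loopSign]

theorem loopSign_mul_loopShift (i j : Fin p ⊕ Fin m) :
    loopSign p m j * loopShift p m i j = -loopShift p m i j := by
  rcases i with i | i <;> rcases j with j | j <;> simp [loopSign, loopShift]

theorem IsFeedbackInterconnection.apply_eq (hG : IsFeedbackInterconnection P K G)
    (i j : Fin p ⊕ Fin m) :
    G i j = constHom (loopSign p m j) * loopProjection P K i j + constHom (loopShift p m i j) := by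
  have h1 := congrArg constHom (loopSign_mul_self j)
  have h2 := congrArg constHom (loopSign_mul_loopShift i j)
  rw [map_mul, map_one] at h1
  rw [map_mul, map_neg] at h2
  rw [hG.loopProjection_eq]
  linear_combination (-G i j) * h1 - h2

/-- Numerators of the entries of the closed loop over the denominator `pairing 1 v w`. -/
noncomputable def loopNum (v w : (Fin m → Fin p ⊕ Fin m) → ℝ[X]) (i j : Fin p ⊕ Fin m) : ℝ[X] :=
  C (loopSign p m j) * (pairing (1 + Matrix.single j i 1) v w - pairing 1 v w)
    + C (loopShift p m i j) * pairing 1 v w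

theorem CoeffTendsto.loopNum {α : Type*} {l : Filter α}
    {v : α → (Fin m → Fin p ⊕ Fin m) → ℝ[X]} {v' : (Fin m → Fin p ⊕ Fin m) → ℝ[X]}
    (hv : ∀ f, CoeffTendsto l (fun x => v x f) (v' f)) (w : (Fin m → Fin p ⊕ Fin m) → ℝ[X])
    (i j : Fin p ⊕ Fin m) :
    CoeffTendsto l (fun x => HTwoCost.loopNum (v x) w i j) (HTwoCost.loopNum v' w i j) :=
  ((const _).mul ((CoeffTendsto.pairing _ hv w).sub (CoeffTendsto.pairing _ hv w))).add
    ((const _).mul (CoeffTendsto.pairing _ hv w))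

/-- The projection factors through dimension `m`, so its `m × m` minors are products of the Plücker
coordinates of `K` and `P`, divided by the determinant. This is what excludes hidden cancellations
in the loop. -/
theorem det_submatrix_loopProjection (f g : Fin m → Fin p ⊕ Fin m)
    (h : (graphAnnihilator K * graphBasis P).det ≠ 0) :
    (graphAnnihilator K * graphBasis P).det * ((loopProjection P K).submatrix g f).det
      = graphMinor K f * basisMinor P g := by
  have e : (loopProjection P K).submatrix g f = (graphBasis P).submatrix g id
      * (graphAnnihilator K * graphBasis P)⁻¹ * (graphAnnihilator K).submatrix id f := rfl
  rw [e, Matrix.det_mul, Matrix.det_mul, Matrix.det_nonsing_inv, Ring.inverse_eq_inv', graphMinor,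
    basisMinor]
  field_simp

theorem natDegree_det_le {n : ℕ} {M : Matrix (Fin n) (Fin n) ℝ[X]} {e : ℕ}
    (h : ∀ i j, (M i j).natDegree ≤ e) : M.det.natDegree ≤ n * e := by
  rw [Matrix.det_apply']
  refine natDegree_sum_le_of_forall_le _ _ fun σ _ => natDegree_mul_le.trans ?_
  rw [natDegree_intCast, zero_add]
  refine (natDegree_prod_le _ _).trans ?_
  simpa using Finset.sum_le_sum (s := Finset.univ) fun i _ => h (σ i) i

theorem exists_aeval_ne_zero {ι : Type*} {v : ι → ℝ[X]} (hv : Ideal.span (Set.range v) = ⊤)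
    (z : ℂ) : ∃ x, aeval z (v x) ≠ 0 := by
  by_contra! h
  have h1 : Ideal.span (Set.range v) ≤ RingHom.ker (aeval z : ℝ[X] →ₐ[ℝ] ℂ) := by
    rw [Ideal.span_le]
    rintro _ ⟨x, rfl⟩
    exact h x
  have h2 : (1 : ℝ[X]) ∈ RingHom.ker (aeval z : ℝ[X] →ₐ[ℝ] ℂ) := h1 (hv ▸ Submodule.mem_top)
  rw [RingHom.mem_ker, map_one] at h2
  exact one_ne_zero h2

/-- Over a common denominator `D` of the entries of a proper `G`, the minors of the loop
projection give polynomial identities. -/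
theorem exists_common_denom (hG : IsFeedbackInterconnection P K G) (hs : IsStrictlyProper G)
    {v w : (Fin m → Fin p ⊕ Fin m) → ℝ[X]} {h k : RatFunc ℝ}
    (hv : ∀ f, algebraMap ℝ[X] (RatFunc ℝ) (v f) = h * graphMinor K f)
    (hw : ∀ g, algebraMap ℝ[X] (RatFunc ℝ) (w g) = k * basisMinor P g) :
    ∃ D : ℝ[X], D = ∏ i, ∏ j, (G i j).denom ∧ ∀ f g, ∃ t : ℝ[X],
      t.natDegree ≤ m * D.natDegree ∧ v f * w g * D ^ m = pairing 1 v w * t := by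
  classical
  obtain ⟨D, hD⟩ : ∃ D, D = ∏ i, ∏ j, (G i j).denom := ⟨_, rfl⟩
  have hD0 : D ≠ 0 := hD ▸ Finset.prod_ne_zero_iff.2 fun i _ => Finset.prod_ne_zero_iff.2 fun j _ =>
    RatFunc.denom_ne_zero _
  have hinj := RatFunc.algebraMap_injective ℝ
  have hN : ∀ i j, ∃ t : ℝ[X], t.natDegree ≤ D.natDegree ∧
      algebraMap ℝ[X] (RatFunc ℝ) t = algebraMap ℝ[X] (RatFunc ℝ) D * G i j := by
    intro i j
    obtain ⟨r, hr⟩ : (G i j).denom ∣ D :=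
      hD ▸ (Finset.dvd_prod_of_mem (fun j => (G i j).denom) (Finset.mem_univ j)).trans
        (Finset.dvd_prod_of_mem (fun i => ∏ j, (G i j).denom) (Finset.mem_univ i))
    have hr0 : r ≠ 0 := by rintro rfl; exact hD0 (by rw [hr, mul_zero])
    refine ⟨(G i j).num * r, ?_, ?_⟩
    · rw [hr]
      refine natDegree_le_natDegree ?_
      rw [degree_mul, degree_mul]
      exact add_le_add_left (hs i j).le _
    · have hd : algebraMap ℝ[X] (RatFunc ℝ) (G i j).denom ≠ 0 :=
        (map_ne_zero_iff _ hinj).2 (RatFunc.denom_ne_zero _)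
      have hn := RatFunc.num_div_denom (G i j)
      rw [div_eq_iff hd] at hn
      rw [hr, map_mul, map_mul, hn]
      ring
  choose N hNd hN using hN
  let N' : Matrix (Fin p ⊕ Fin m) (Fin p ⊕ Fin m) ℝ[X] := Matrix.of fun i j =>
    C (loopSign p m j) * N i j + C (loopShift p m i j) * D
  have hN' : N'.map (algebraMap ℝ[X] (RatFunc ℝ))
      = algebraMap ℝ[X] (RatFunc ℝ) D • loopProjection P K := by
    ext1 i j
    simp only [N', Matrix.map_apply, Matrix.of_apply, Matrix.smul_apply, smul_eq_mul,
      hG.loopProjection_eq, map_add, map_mul, hN]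
    simp only [constHom, RingHom.comp_apply]
    ring
  refine ⟨D, hD, fun f g => ⟨(N'.submatrix g f).det, natDegree_det_le fun i j => ?_, ?_⟩⟩
  · simp only [N', Matrix.submatrix_apply, Matrix.of_apply]
    exact natDegree_add_le_of_degree_le ((natDegree_C_mul_le _ _).trans (hNd _ _))
      (natDegree_C_mul_le _ _)
  · apply hinj
    have h1 : algebraMap ℝ[X] (RatFunc ℝ) (N'.submatrix g f).det
        = algebraMap ℝ[X] (RatFunc ℝ) D ^ m * ((loopProjection P K).submatrix g f).det := by
      rw [RingHom.map_det]
      have : (algebraMap ℝ[X] (RatFunc ℝ)).mapMatrix (N'.submatrix g f)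
          = (algebraMap ℝ[X] (RatFunc ℝ) D) • (loopProjection P K).submatrix g f := by
        rw [RingHom.mapMatrix_apply, ← Matrix.submatrix_map, hN']
        rfl
      rw [this, Matrix.det_smul, Fintype.card_fin]
    have h2 := algebraMap_pairing 1 hv hw
    rw [Matrix.map_one _ (map_zero _) (map_one _), Matrix.one_mul] at h2
    have h3 := det_submatrix_loopProjection f g hG.det_ne_zero
    rw [map_mul, map_mul, map_mul, map_pow, h1, h2, hv, hw]
    linear_combination (-(h * k * algebraMap ℝ[X] (RatFunc ℝ) D ^ m)) * h3

/-- All products `v f * w g` are multiples of the denominator up to a power of `D`, whose roots are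
poles of `G`. Since neither `v` nor `w` has a common root, a root of the denominator that is no pole
is impossible; the same comparison at infinity fixes the degree. -/
theorem isFractionRep_loop (hG : IsFeedbackInterconnection P K G) (hs : IsStrictlyProper G)
    {v w : (Fin m → Fin p ⊕ Fin m) → ℝ[X]} {d δ : ℕ} (hv : IsPrimitiveRep (graphMinor K) d v)
    (hw : IsPrimitiveRep (basisMinor P) δ w) :
    IsFractionRep G (pairing 1 v w) (loopNum v w) ∧ (pairing 1 v w).natDegree = d + δ := by
  obtain ⟨h, h0, hvh⟩ := hv.exists_scale
  obtain ⟨k, k0, hwk⟩ := hw.exists_scale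
  have hinj := RatFunc.algebraMap_injective ℝ
  have hdet := hG.det_ne_zero
  have hq := algebraMap_pairing 1 hvh hwk
  rw [Matrix.map_one _ (map_zero _) (map_one _), Matrix.one_mul] at hq
  have hq0 : algebraMap ℝ[X] (RatFunc ℝ) (pairing 1 v w) ≠ 0 := by
    rw [hq]
    exact mul_ne_zero (mul_ne_zero h0 k0) hdet
  have hq0' : pairing 1 v w ≠ 0 := fun h => hq0 (by rw [h, map_zero])
  have heq : ∀ i j, G i j = algebraMap ℝ[X] (RatFunc ℝ) (loopNum v w i j)
      / algebraMap ℝ[X] (RatFunc ℝ) (pairing 1 v w) := by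
    intro i j
    -- The perturbation at `(j, i)` multiplies the determinant by `1 + Q i j`, so the difference of
    -- the two pairings is the numerator of `Q i j`.
    have h1 := algebraMap_pairing (1 + Matrix.single j i 1) hvh hwk
    have h2 : (1 + Matrix.single j i (1 : ℝ)).map constHom
        = (1 + Matrix.single j i 1 : TransferMatrix (Fin p ⊕ Fin m) (Fin p ⊕ Fin m)) := by
      rw [Matrix.map_add _ (map_add _), Matrix.map_one _ (map_zero _) (map_one _),
        Matrix.map_single, map_one]
    rw [h2, det_mul_one_add_single_mul _ _ hdet] at h1
    change _ = h * k * (_ * (1 + loopProjection P K i j)) at h1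
    rw [eq_div_iff hq0, loopNum, map_add, map_mul, map_mul, map_sub, h1, hq, hG.apply_eq]
    simp only [constHom, RingHom.comp_apply]
    ring
  obtain ⟨D, hD, ht⟩ := exists_common_denom hG hs hvh hwk
  have hD0 : D ≠ 0 := hD ▸ Finset.prod_ne_zero_iff.2 fun i _ =>
    Finset.prod_ne_zero_iff.2 fun j _ => RatFunc.denom_ne_zero _
  refine ⟨⟨hq0', heq, fun i j => ?_, fun z hz => ?_⟩, le_antisymm ?_ ?_⟩
  · have h1 := (RatFunc.num_mul_eq_mul_denom_iff hq0').2 (heq i j)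
    have h2 := congrArg degree h1
    rw [degree_mul, degree_mul] at h2
    by_contra! hle
    have h3 : (G i j).num.degree + (pairing 1 v w).degree
        < (G i j).denom.degree + (pairing 1 v w).degree :=
      WithBot.add_lt_add_right (degree_ne_bot.2 hq0') (hs i j)
    rw [h2, add_comm] at h3
    exact h3.not_ge (add_le_add_right hle _)
  · by_contra! hne
    have hDz : aeval z D ≠ 0 := by
      rw [hD, map_prod]
      refine Finset.prod_ne_zero_iff.2 fun i _ => ?_
      rw [map_prod]
      exact Finset.prod_ne_zero_iff.2 fun j _ => hne i j
    obtain ⟨f, hf⟩ := exists_aeval_ne_zero hv.span_eq_top z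
    obtain ⟨g, hg⟩ := exists_aeval_ne_zero hw.span_eq_top z
    obtain ⟨t, -, ht⟩ := ht f g
    have := congrArg (aeval z) ht
    rw [map_mul, map_mul, map_mul, map_pow, hz, zero_mul] at this
    exact mul_ne_zero (mul_ne_zero hf hg) (pow_ne_zero _ hDz) this
  · exact natDegree_pairing_le 1 hv.natDegree_le hw.natDegree_le
  -- Coordinates of top degree `d` and `δ` are compared with `t`, whose degree is at most that of `D
  -- ^ m`; this bound on `t` is where properness enters.
  · obtain ⟨f, hf⟩ := hv.exists_coeff_ne_zero
    obtain ⟨g, hg⟩ := hw.exists_coeff_ne_zero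
    obtain ⟨t, htd, ht⟩ := ht f g
    have hvf : v f ≠ 0 := fun h => hf (by rw [h, coeff_zero])
    have hwg : w g ≠ 0 := fun h => hg (by rw [h, coeff_zero])
    have ht0 : t ≠ 0 := by
      rintro rfl
      rw [mul_zero] at ht
      exact mul_ne_zero (mul_ne_zero hvf hwg) (pow_ne_zero _ hD0) ht
    have h1 := congrArg natDegree ht
    rw [natDegree_mul (mul_ne_zero hvf hwg) (pow_ne_zero _ hD0), natDegree_mul hvf hwg,
      natDegree_pow, natDegree_mul hq0' ht0] at h1
    have h2 := le_natDegree_of_ne_zero hf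
    have h3 := le_natDegree_of_ne_zero hg
    omega

end Loop

/-! ### Continuity of primitive representatives of constant degree -/

namespace IsPrimitiveRep

variable {ι : Type*} {a : ι → RatFunc ℝ} {d : ℕ} {v : ι → ℝ[X]}

theorem C_mul (hv : IsPrimitiveRep a d v) {c : ℝ} (hc : c ≠ 0) :
    IsPrimitiveRep a d fun x => C c * v x := by
  obtain ⟨⟨h, h0, hh⟩, hspan, hdeg, ⟨y, hy⟩⟩ := hv
  refine ⟨⟨algebraMap ℝ[X] (RatFunc ℝ) (C c) * h, mul_ne_zero ?_ h0, fun x => ?_⟩, ?_,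
    fun x => (natDegree_C_mul_le _ _).trans (hdeg x), ⟨y, ?_⟩⟩
  · exact (map_ne_zero_iff _ (RatFunc.algebraMap_injective ℝ)).2 (C_ne_zero.2 hc)
  · rw [map_mul, hh, mul_assoc]
  · rw [eq_top_iff, ← hspan, Ideal.span_le]
    rintro _ ⟨z, rfl⟩
    have : v z = C c⁻¹ * (C c * v z) := by
      rw [← mul_assoc, ← Polynomial.C_mul, inv_mul_cancel₀ hc, C_1, one_mul]
    rw [this]
    exact Ideal.mul_mem_left _ _ (Ideal.subset_span ⟨z, rfl⟩)
  · rw [coeff_C_mul]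
    exact mul_ne_zero hc hy

/-- Among families of degree at most `d`, a primitive family of degree `d` is determined up to a
constant by its ratios. -/
theorem of_cross_eq [Fintype ι] (hv : IsPrimitiveRep a d v) {u : ι → ℝ[X]}
    (hcross : ∀ i j, v i * u j = v j * u i) (hdeg : ∀ i, (u i).natDegree ≤ d) (hu : ∃ i, u i ≠ 0) :
    IsPrimitiveRep a d u := by
  obtain ⟨c, hc⟩ := Ideal.mem_span_range_iff_exists_fun.1
    (hv.span_eq_top ▸ Submodule.mem_top : (1 : ℝ[X]) ∈ Ideal.span (Set.range v))
  -- The Bézout coefficients of `v` give the factor `H` with `u = H * v`; an entry of `v` of degree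
  -- `d` then forces `H` to be constant.
  set H := ∑ i, c i * u i with hH
  have hu' : ∀ j, u j = H * v j := by
    intro j
    calc u j = (∑ i, c i * v i) * u j := by rw [hc, one_mul]
      _ = H * v j := by
        rw [hH, Finset.sum_mul, Finset.sum_mul]
        refine Finset.sum_congr rfl fun i _ => ?_
        linear_combination c i * hcross i j
  have hH0 : H ≠ 0 := by
    intro h
    obtain ⟨i, hi⟩ := hu
    exact hi (by rw [hu', h, zero_mul])
  obtain ⟨y, hy⟩ := hv.exists_coeff_ne_zero
  have hvy : v y ≠ 0 := fun h => hy (by rw [h, coeff_zero])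
  have h1 := hdeg y
  rw [hu', natDegree_mul hH0 hvy] at h1
  have h2 := le_natDegree_of_ne_zero hy
  obtain ⟨r, hr⟩ := natDegree_eq_zero.1 (by omega : H.natDegree = 0)
  have hr0 : r ≠ 0 := by
    rintro rfl
    exact hH0 (by rw [← hr, C_0])
  have h3 : u = fun x => C r * v x := funext fun x => by rw [hu', hr]
  rw [h3]
  exact hv.C_mul hr0

end IsPrimitiveRep

theorem cross_eq_of_scale {ι : Type*} {a : ι → RatFunc ℝ} {v w : ι → ℝ[X]} {h k : RatFunc ℝ}
    (hv : ∀ x, algebraMap ℝ[X] (RatFunc ℝ) (v x) = h * a x)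
    (hw : ∀ x, algebraMap ℝ[X] (RatFunc ℝ) (w x) = k * a x) (i j : ι) :
    v i * w j = v j * w i := by
  apply RatFunc.algebraMap_injective ℝ
  rw [map_mul, map_mul, hv, hv, hw, hw]
  ring

/-- A non-zero limit of primitive representatives of degree `d` of points with continuously varying
homogeneous coordinates is a primitive representative of the limit point, if that has degree `d`. -/
theorem IsPrimitiveRep.of_coeffTendsto {α ι : Type*} [Fintype ι] {l : Filter α} [l.NeBot] {d : ℕ}
    {a : α → ι → RatFunc ℝ} {a' : ι → RatFunc ℝ} {v W : α → ι → ℝ[X]} {v' W' u : ι → ℝ[X]}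
    (hv : ∀ᶠ x in l, IsPrimitiveRep (a x) d (v x))
    (hW : ∀ᶠ x in l, ∃ h : RatFunc ℝ, ∀ i, algebraMap ℝ[X] (RatFunc ℝ) (W x i) = h * a x i)
    (hv' : IsPrimitiveRep a' d v')
    (hW' : ∃ h : RatFunc ℝ, h ≠ 0 ∧ ∀ i, algebraMap ℝ[X] (RatFunc ℝ) (W' i) = h * a' i)
    (hvu : ∀ i, CoeffTendsto l (fun x => v x i) (u i))
    (hWW : ∀ i, CoeffTendsto l (fun x => W x i) (W' i)) (hu : ∃ i, u i ≠ 0) :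
    IsPrimitiveRep a' d u := by
  -- Proportionality is expressed by cross products of polynomials, which pass to the limit, unlike
  -- the rational scale factors.
  have h1 : ∀ i j, W' i * u j = W' j * u i := fun i j => by
    refine ((hWW i).mul (hvu j)).unique (((hWW j).mul (hvu i)).congr' ?_)
    filter_upwards [hv, hW] with x hx ⟨h, hh⟩
    obtain ⟨k, -, hk⟩ := hx.exists_scale
    exact (cross_eq_of_scale hh hk i j).symm
  obtain ⟨h, h0, hh⟩ := hW'
  obtain ⟨k, k0, hk⟩ := hv'.exists_scale
  refine hv'.of_cross_eq (fun i j => ?_) (fun i => ?_) hu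
  · apply RatFunc.algebraMap_injective ℝ
    have h2 := congrArg (algebraMap ℝ[X] (RatFunc ℝ)) (h1 i j)
    rw [map_mul, map_mul, hh, hh, mul_assoc, mul_assoc] at h2
    rw [map_mul, map_mul, hk, hk, mul_assoc, mul_assoc, mul_left_cancel₀ h0 h2]
  · refine natDegree_le_iff_coeff_eq_zero.2 fun n hn => ?_
    refine tendsto_nhds_unique ((hvu i) n) (tendsto_const_nhds.congr' ?_)
    filter_upwards [hv] with x hx
    exact (coeff_eq_zero_of_natDegree_lt ((hx.natDegree_le i).trans_lt hn)).symm

/-! ### Compactness of normalised representatives and the final assembly. -/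

/-- The vector of all coefficients up to degree `d` of a finite family of polynomials. -/
def coeffVector {ι : Type*} (d : ℕ) (v : ι → ℝ[X]) : ι × Fin (d + 1) → ℝ := fun x =>
  (v x.1).coeff x.2

theorem IsPrimitiveRep.exists_norm_eq_one {ι : Type*} [Fintype ι] {a : ι → RatFunc ℝ} {d : ℕ}
    {v : ι → ℝ[X]} (hv : IsPrimitiveRep a d v) :
    ∃ u, IsPrimitiveRep a d u ∧ ‖coeffVector d u‖ = 1 := by
  have h0 : coeffVector d v ≠ 0 := by
    obtain ⟨y, hy⟩ := hv.exists_coeff_ne_zero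
    intro h
    exact hy (by simpa [coeffVector] using congrFun h (y, Fin.last d))
  have h1 : ‖coeffVector d v‖ ≠ 0 := norm_ne_zero_iff.2 h0
  refine ⟨_, hv.C_mul (inv_ne_zero h1), ?_⟩
  have : coeffVector d (fun x => C ‖coeffVector d v‖⁻¹ * v x)
      = ‖coeffVector d v‖⁻¹ • coeffVector d v := by
    ext x
    simp [coeffVector]
  rw [this, norm_smul, norm_inv, norm_norm, inv_mul_cancel₀ h1]

/-- Normalised families of bounded degree have coefficientwise convergent subsequences. -/
theorem exists_subseq_coeffTendsto {ι : Type*} [Fintype ι] {d : ℕ} {v : ℕ → ι → ℝ[X]}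
    (hdeg : ∀ᶠ n in atTop, ∀ i, (v n i).natDegree ≤ d)
    (hnorm : ∀ᶠ n in atTop, ‖coeffVector d (v n)‖ = 1) :
    ∃ (u : ι → ℝ[X]) (φ : ℕ → ℕ), StrictMono φ ∧ (∃ i, u i ≠ 0) ∧
      ∀ i, CoeffTendsto atTop (fun n => v (φ n) i) (u i) := by
  obtain ⟨x, hx, φ, hφ, hlim⟩ := (isCompact_sphere (0 : ι × Fin (d + 1) → ℝ) 1).tendsto_subseq'
    (x := fun n => coeffVector d (v n))
    ((hnorm.mono fun n hn => by simpa using hn).frequently)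
  let u : ι → ℝ[X] := fun i => ∑ k : Fin (d + 1), monomial k (x (i, k))
  have hu : ∀ i (k : Fin (d + 1)), (u i).coeff k = x (i, k) := by
    intro i k
    simp [u, coeff_monomial, Fin.val_inj]
  have hu' : ∀ i k, d < k → (u i).coeff k = 0 := by
    intro i k hk
    simp only [u, finsetSum_coeff, coeff_monomial]
    refine Finset.sum_eq_zero fun b _ => if_neg ?_
    have := b.2
    omega
  refine ⟨u, φ, hφ, ?_, fun i k => ?_⟩
  · by_contra! h
    have : x = 0 := by
      ext ⟨i, k⟩
      rw [← hu, h i, coeff_zero]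
      rfl
    simp [this] at hx
  · by_cases hk : k ≤ d
    · have h1 := (tendsto_pi_nhds.1 hlim) (i, ⟨k, Nat.lt_succ_of_le hk⟩)
      rw [← hu] at h1
      exact h1
    · push Not at hk
      rw [hu' i k hk]
      refine tendsto_const_nhds.congr' ?_
      filter_upwards [hφ.tendsto_atTop.eventually hdeg] with n hn
      exact (coeff_eq_zero_of_natDegree_lt ((hn i).trans_lt hk)).symm

/-- Continuous coefficients of `K` yield polynomial homogeneous coordinates of its graph with
continuous coefficients. -/
theorem HasContinuousCoefficients.exists_polynomial_graphMinor {E : Type} [TopologicalSpace E]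
    {m p : ℕ} {K : E → TransferMatrix (Fin m) (Fin p)} {D : Set E}
    (hK : HasContinuousCoefficients K D) :
    ∃ W : E → (Fin m → Fin p ⊕ Fin m) → ℝ[X],
      (∀ μ ∈ D, ∀ f, CoeffTendsto (𝓝[D] μ) (fun x => W x f) (W μ f)) ∧
      ∀ μ ∈ D, ∃ h : RatFunc ℝ, h ≠ 0 ∧
        ∀ f, algebraMap ℝ[X] (RatFunc ℝ) (W μ f) = h * graphMinor (K μ) f := by
  classical
  choose N num den hnum hden hq using hK
  let s : Finset (Fin m × Fin p) := Finset.univ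
  -- Clearing all denominators at once keeps the coefficients continuous, at the price of common
  -- factors: `W` need not be primitive.
  let b : E → ℝ[X] := fun μ => ∏ x ∈ s, den x.1 x.2 μ
  let A : E → Matrix (Fin m) (Fin p ⊕ Fin m) ℝ[X] := fun μ => Matrix.fromCols
    (Matrix.of fun i j => -(num i j μ * ∏ x ∈ s.erase (i, j), den x.1 x.2 μ))
    (Matrix.diagonal fun _ => b μ)
  have hcd : ∀ μ ∈ D, ∀ i j, CoeffTendsto (𝓝[D] μ) (den i j) (den i j μ) :=
    fun μ hμ i j k => hden i j k μ hμ
  have hcn : ∀ μ ∈ D, ∀ i j, CoeffTendsto (𝓝[D] μ) (num i j) (num i j μ) :=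
    fun μ hμ i j k => hnum i j k μ hμ
  refine ⟨fun μ f => ((A μ).submatrix id f).det, fun μ hμ f => ?_, fun μ hμ => ?_⟩
  · refine CoeffTendsto.det fun i j => ?_
    simp only [Matrix.submatrix_apply, A]
    rcases f j with c | r
    · simp only [Matrix.fromCols_apply_inl, Matrix.of_apply]
      exact ((hcn μ hμ _ _).mul (CoeffTendsto.prod fun x _ => hcd μ hμ _ _)).neg
    · simp only [Matrix.fromCols_apply_inr, Matrix.diagonal_apply]
      split_ifs
      · exact CoeffTendsto.prod fun x _ => hcd μ hμ _ _
      · exact CoeffTendsto.const 0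
  · have hb : b μ ≠ 0 := Finset.prod_ne_zero_iff.2 fun x _ => (hq x.1 x.2 μ hμ).2.2.1
    have hinj := RatFunc.algebraMap_injective ℝ
    have hb' : algebraMap ℝ[X] (RatFunc ℝ) (b μ) ≠ 0 := (map_ne_zero_iff _ hinj).2 hb
    have hA : (A μ).map (algebraMap ℝ[X] (RatFunc ℝ))
        = algebraMap ℝ[X] (RatFunc ℝ) (b μ) • graphAnnihilator (K μ) := by
      ext1 i c
      rcases c with j | r
      · have h1 : b μ = den i j μ * ∏ x ∈ s.erase (i, j), den x.1 x.2 μ :=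
          (Finset.mul_prod_erase s (fun x => den x.1 x.2 μ) (Finset.mem_univ (i, j))).symm
        have h2 : algebraMap ℝ[X] (RatFunc ℝ) (den i j μ) ≠ 0 :=
          (map_ne_zero_iff _ hinj).2 (hq i j μ hμ).2.2.1
        simp only [A, graphAnnihilator, Matrix.map_apply, Matrix.fromCols_apply_inl,
          Matrix.of_apply, Matrix.smul_apply, Matrix.neg_apply, smul_eq_mul, (hq i j μ hμ).2.2.2]
        rw [h1]
        simp only [map_neg, map_mul]
        field_simp
      · simp only [A, graphAnnihilator, Matrix.map_apply, Matrix.fromCols_apply_inr,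
          Matrix.smul_apply, Matrix.diagonal_apply, Matrix.one_apply, smul_eq_mul]
        split_ifs <;> simp
    refine ⟨_, pow_ne_zero m hb', fun f => ?_⟩
    have h3 : (algebraMap ℝ[X] (RatFunc ℝ)).mapMatrix ((A μ).submatrix id f)
        = algebraMap ℝ[X] (RatFunc ℝ) (b μ) • (graphAnnihilator (K μ)).submatrix id f := by
      rw [RingHom.mapMatrix_apply, ← Matrix.submatrix_map, hA]
      rfl
    rw [RingHom.map_det, h3, Matrix.det_smul, Fintype.card_fin]
    rfl

/-- The normalised representatives `V` are chosen arbitrarily and need not vary continuously, for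
instance in sign. It suffices that each sequence has a subsequence along which they converge to some
primitive representative at `μ`, since any of these describes the same `G μ`. -/
theorem continuousOn_h2NormSq {E : Type} [TopologicalSpace E] [FirstCountableTopology E] {p m : ℕ}
    {D : Set E} {P : TransferMatrix (Fin p) (Fin m)} {K : E → TransferMatrix (Fin m) (Fin p)}
    {G : E → TransferMatrix (Fin p ⊕ Fin m) (Fin p ⊕ Fin m)}
    (hG : ∀ μ ∈ D, IsFeedbackInterconnection P (K μ) (G μ))
    (hdeg : ∃ d : ℕ, ∀ μ ∈ D, mcMillanDegree (K μ) = d) (hK : HasContinuousCoefficients K D)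
    (hproper : ∀ μ ∈ D, IsStrictlyProper (G μ)) :
    ContinuousOn (fun μ => h2NormSq (G μ)) D := by
  obtain ⟨d, hd⟩ := hdeg
  obtain ⟨W, hWlim, hW⟩ := hK.exists_polynomial_graphMinor
  obtain ⟨w, hw⟩ := isPrimitiveRep_lcm_denom (basisMinor P) Sum.inr (basisMinor_inr P)
  have hV : ∀ μ, ∃ v : (Fin m → Fin p ⊕ Fin m) → ℝ[X], μ ∈ D →
      IsPrimitiveRep (graphMinor (K μ)) d v ∧ ‖coeffVector d v‖ = 1 := by
    intro μ
    by_cases hμ : μ ∈ D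
    · obtain ⟨v, hv⟩ := exists_isPrimitiveRep_graphMinor (K μ)
      rw [hd μ hμ] at hv
      obtain ⟨u, hu⟩ := hv.exists_norm_eq_one
      exact ⟨u, fun _ => hu⟩
    · exact ⟨0, fun h => absurd h hμ⟩
  choose V hV using hV
  intro μ hμ
  refine tendsto_of_subseq_tendsto fun ns hns => ?_
  have hnsD : ∀ᶠ n in atTop, ns n ∈ D := hns.eventually self_mem_nhdsWithin
  obtain ⟨u, φ, hφ, hu0, hlim⟩ := exists_subseq_coeffTendsto (d := d) (v := fun n => V (ns n))
    (hnsD.mono fun n hn => (hV _ hn).1.natDegree_le) (hnsD.mono fun n hn => (hV _ hn).2)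
  have hφD : ∀ᶠ n in atTop, ns (φ n) ∈ D := hφ.tendsto_atTop.eventually hnsD
  have hu : IsPrimitiveRep (graphMinor (K μ)) d u :=
    IsPrimitiveRep.of_coeffTendsto (hφD.mono fun n hn => (hV _ hn).1)
      (W := fun n => W (ns (φ n)))
      (hφD.mono fun n hn => (hW _ hn).imp fun _ h => h.2) (hV μ hμ).1 (hW μ hμ) hlim
      (fun f => (hWlim μ hμ f).comp (hns.comp hφ.tendsto_atTop)) hu0
  have hrep := isFractionRep_loop (hG μ hμ) (hproper μ hμ) hu hw
  have hreps := hφD.mono fun n hn =>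
    isFractionRep_loop (hG _ hn) (hproper _ hn) (hV _ hn).1 hw
  exact ⟨φ, tendsto_h2NormSq (hreps.mono fun n h => h.1) hrep.1 (CoeffTendsto.pairing 1 hlim w)
    (fun i j => CoeffTendsto.loopNum hlim w i j) (hreps.mono fun n h => h.2) hrep.2⟩

end HTwoCost

theorem theorem5 (n p m : ℕ) (D : Set (EuclideanSpace ℝ (Fin n))) (hD : IsOpen D)
    (P : HTwoCost.TransferMatrix (Fin p) (Fin m))
    (K : EuclideanSpace ℝ (Fin n) → HTwoCost.TransferMatrix (Fin m) (Fin p))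
    (G : EuclideanSpace ℝ (Fin n) → HTwoCost.TransferMatrix (Fin p ⊕ Fin m) (Fin p ⊕ Fin m))
    (hG : ∀ μ ∈ D, HTwoCost.IsFeedbackInterconnection P (K μ) (G μ))
    (hdeg : ∃ d : ℕ, ∀ μ ∈ D, HTwoCost.mcMillanDegree (K μ) = d)
    (hK : HTwoCost.HasContinuousCoefficients K D)
    (hproper : ∀ μ ∈ D, HTwoCost.IsStrictlyProper (G μ)) :
    ContinuousOn (fun μ => (1 / 2 : ENNReal) * HTwoCost.h2NormSq (G μ)) D := by

  intro μ hμ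
  exact ENNReal.Tendsto.const_mul (HTwoCost.continuousOn_h2NormSq hG hdeg hK hproper μ hμ)
    (Or.inr (ENNReal.div_ne_top ENNReal.one_ne_top two_ne_zero))
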